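/- Let $0<r<R<\infty$ and let $P\subset\mathbb R^2$ be an $(r,R)$-system, i.e. the discs of radius $r$ centred at the points of $P$ form a packing and the discs of radius $R$ centred at the points of $P$ cover the plane. Suppose that $R/r\le 2\sqrt2$. Let $\mathcal T$ be a Delone (Delaunay) triangulation associated to $P$, i.e. a face-to-face triangulation of the plane by triangles with vertices in $P$ whose open circumdiscs contain no point of $P$ (Delone polygons with more than three sides are triangulated arbitrarily). Then the triangles of $\mathcal T$ can be partitioned into groups, each of which is of one of the following types: (1) a single non-obtuse triangle; (2) a single obtuse triangle of area at least $2r^2$; (3) one non-obtuse triangle $T$ together with one, two or three obtuse triangles whose longest sides coincide with sides of $T$, these two, three or four triangles having average area at least $2r^2$; (4) one obtuse triangle $T$ together with one or two further obtuse triangles whose longest sides coincide with sides of $T$ but not with the longest side of $T$, these two or three triangles having average area at least $2r^2$. In particular, $\mathcal T$ contains non-obtuse triangles, and if $V_0=V_0(\mathcal T)$ denotes the infimum of their areas, then the average area of the triangles of $\mathcal T$ is at least $\min\{V_0,2r^2\}$: for every $\varepsilon>0$ there is $\rho_0$ such that for all $\rho\ge\rho_0$ and $x\in\mathbb R^2$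 the arithmetic mean of the areas of the triangles of $\mathcal T$ contained in the disc of centre $x$ and radius $\rho$ is at least $\min\{V_0,2r^2\}-\varepsilon$. This bound is sharp in the following sense. For every $\varepsilon>0$ there are an $(r,R)$-system $P'$, a Delone triangulation $\mathcal T'$ associated to it and a number $a\in[V_0,V_0+\varepsilon)$ such that all triangles of $\mathcal T'$ are non-obtuse and have area $a$; thus $V_0(\mathcal T')=a$, and the average area of the triangles of $\mathcal T'$ (the limit, as $\rho\to\infty$, of the above means, uniform in $x$) equals $a$. Moreover, there are an $(r,\sqrt2\,r)$-system and a Delone triangulation associated to it all of whose triangles are non-obtuse and have area $2r^2$; thus its infimum of the areas of the non-obtuse triangles and its average area both equal $2r^2$. -/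

import Mathlib

open MeasureTheory

noncomputable section

/-- The Euclidean plane. -/
abbrev Plane : Type := EuclideanSpace ℝ (Fin 2)

/-- `P` is an `(r,R)`-system: the balls of radius `r` centred at the points of `P` form a packing,
and the balls of radius `R` centred at the points of `P` form a covering. -/
structure IsRRSystem (r R : ℝ) (P : Set Plane) : Prop where
  r_pos : 0 < r
  r_lt_R : r < R
  packing : P.PairwiseDisjoint (fun p => Metric.ball p r)
  covering : (⋃ p ∈ P, Metric.closedBall p R) = Set.univ

/-- A triangle is given by its set of vertices: three points that do not lie on a line. -/
def IsTriangle (t : Finset Plane) : Prop :=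
  t.card = 3 ∧ AffineIndependent ℝ (fun x : t => (x : Plane))

/-- The point set of a triangle. -/
def region (t : Finset Plane) : Set Plane := convexHull ℝ (t : Set Plane)

/-- The area of a triangle. -/
def area (t : Finset Plane) : ℝ := (volume (region t)).toReal

/-- `t` has an angle greater than `π / 2`. (`∠ a b c ≤ π / 2` whenever two of the three points
coincide, so distinctness of the vertices need not be required.) -/
def IsObtuse (t : Finset Plane) : Prop :=
  ∃ a ∈ t, ∃ b ∈ t, ∃ c ∈ t, Real.pi / 2 < EuclideanGeometry.angle a b c

/-- `e` is a longest side of `t`; a side is given by its two endpoints. -/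
def IsLongestSide (e t : Finset Plane) : Prop :=
  e ⊆ t ∧ e.card = 2 ∧
    ∀ a ∈ e, ∀ b ∈ e, a ≠ b → ∀ x ∈ t, ∀ y ∈ t, dist x y ≤ dist a b

/-- No point of `P` lies inside the circumcircle of `t`. -/
def HasEmptyCircumcircle (P : Set Plane) (t : Finset Plane) : Prop :=
  ∃ (c : Plane) (ρ : ℝ), (∀ p ∈ t, dist p c = ρ) ∧ ∀ p ∈ P, ρ ≤ dist p c

/-- `𝒯` is a Delone triangulation associated to `P`: a face-to-face triangulation of the plane by
triangles with vertices in `P` and with empty circumcircles. Thus each Delone polygon (the convex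
hull of the points of `P` on an empty circle) is triangulated in an arbitrary way by triangles
with the same vertices. -/
structure IsDeloneTriangulation (P : Set Plane) (𝒯 : Set (Finset Plane)) : Prop where
  isTriangle : ∀ t ∈ 𝒯, IsTriangle t
  vertices : ∀ t ∈ 𝒯, (t : Set Plane) ⊆ P
  empty_circle : ∀ t ∈ 𝒯, HasEmptyCircumcircle P t
  cover : (⋃ t ∈ 𝒯, region t) = Set.univ
  face_to_face : ∀ s ∈ 𝒯, ∀ t ∈ 𝒯,
    region s ∩ region t = convexHull ℝ ((s : Set Plane) ∩ (t : Set Plane))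

/-- The infimum `V₀` of the areas of the non-obtuse triangles of `𝒯`. -/
def nonObtuseInf (𝒯 : Set (Finset Plane)) : ℝ :=
  sInf (area '' {t | t ∈ 𝒯 ∧ ¬ IsObtuse t})

/-- The triangles of `𝒯` that are contained in the disc with centre `x` and radius `ρ`. -/
def window (𝒯 : Set (Finset Plane)) (x : Plane) (ρ : ℝ) : Set (Finset Plane) :=
  {t | t ∈ 𝒯 ∧ region t ⊆ Metric.closedBall x ρ}

/-- The average area of the finitely many triangles of `𝒯` that are contained in a disc. -/
def windowAverage (𝒯 : Set (Finset Plane)) (x : Plane) (ρ : ℝ) : ℝ :=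
  (∑ᶠ t ∈ window 𝒯 x ρ, area t) / ((window 𝒯 x ρ).ncard : ℝ)

/-- The average area of the triangles of `𝒯` is at least `m`: the lower limit of the averages over
discs of radius `ρ → ∞`, uniformly in their centres, is at least `m`. -/
def AverageAreaAtLeast (𝒯 : Set (Finset Plane)) (m : ℝ) : Prop :=
  ∀ ε : ℝ, 0 < ε → ∃ ρ₀ : ℝ, ∀ ρ : ℝ, ρ₀ ≤ ρ → ∀ x : Plane, m - ε ≤ windowAverage 𝒯 x ρ

/-- The average area of the triangles of `𝒯` exists and equals `m`: the averages over discs of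
radius `ρ → ∞` converge to `m`, uniformly in their centres. -/
def HasAverageArea (𝒯 : Set (Finset Plane)) (m : ℝ) : Prop :=
  ∀ ε : ℝ, 0 < ε → ∃ ρ₀ : ℝ, ∀ ρ : ℝ, ρ₀ ≤ ρ → ∀ x : Plane, |windowAverage 𝒯 x ρ - m| ≤ ε

/-- The triangles of the group `g` have average area at least `m`. -/
def GroupAverageAtLeast (g : Finset (Finset Plane)) (m : ℝ) : Prop :=
  m ≤ (∑ t ∈ g, area t) / (g.card : ℝ)

/-- A group of type (1): a single non-obtuse triangle. -/
def IsGroup1 (g : Finset (Finset Plane)) : Prop :=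
  ∃ T, g = {T} ∧ ¬ IsObtuse T

/-- A group of type (2): a single obtuse triangle, of area at least `2 r ^ 2`. -/
def IsGroup2 (r : ℝ) (g : Finset (Finset Plane)) : Prop :=
  ∃ T, g = {T} ∧ IsObtuse T ∧ 2 * r ^ 2 ≤ area T

/-- A group of type (3): a non-obtuse triangle `T` and one, two or three obtuse triangles whose
longest sides are sides of `T`, with average area at least `2 r ^ 2`. -/
def IsGroup3 (r : ℝ) (g : Finset (Finset Plane)) : Prop :=
  ∃ T ∈ g, ¬ IsObtuse T ∧ 2 ≤ g.card ∧ g.card ≤ 4 ∧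
    (∀ t ∈ g, t ≠ T → IsObtuse t ∧ ∃ e, IsLongestSide e t ∧ e ⊆ T) ∧
    GroupAverageAtLeast g (2 * r ^ 2)

/-- A group of type (4): an obtuse triangle `T` and one or two further obtuse triangles whose
longest sides are sides of `T` but not the longest side of `T`, with average area at
least `2 r ^ 2`. -/
def IsGroup4 (r : ℝ) (g : Finset (Finset Plane)) : Prop :=
  ∃ T ∈ g, IsObtuse T ∧ 2 ≤ g.card ∧ g.card ≤ 3 ∧
    (∀ t ∈ g, t ≠ T →
      IsObtuse t ∧ ∃ e, IsLongestSide e t ∧ e ⊆ T ∧ ¬ IsLongestSide e T) ∧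
    GroupAverageAtLeast g (2 * r ^ 2)

/-- `𝒢` divides the triangles of `𝒯` into groups: every group consists of triangles of `𝒯`, and
every triangle of `𝒯` belongs to exactly one group. -/
def IsGrouping (𝒯 : Set (Finset Plane)) (𝒢 : Set (Finset (Finset Plane))) : Prop :=
  (∀ g ∈ 𝒢, ∀ t ∈ g, t ∈ 𝒯) ∧ ∀ t ∈ 𝒯, ∃! g, g ∈ 𝒢 ∧ t ∈ g

end

/-! ### Inequalities between the areas and the squared sides of triangles -/

/-! Measure lengths in units of r. The packing makes every squared side at least 4. The covering
bounds each circumradius by R, so its square is at most 8; as the product of the sides is four times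
circumradius times area, the product of the squared sides is at most 128 times the squared area
(`IsDeloneTriangulation.metric_bounds`). These facts alone allow an obtuse triangle to have area
below 2, so its deficit is charged to its parent, the neighbour across its longest side
(`IsChildAt`).

If p is the squared longest side of a child of area A, then A ≥ 1 and 16A² ≥ 64 - (p - 8)²: a small
child has a long base, which also makes the parent large. With several children this is not enough
when the parent is non-obtuse. There the Delone property enters: the two angles facing the common
side sum to at most π (`delone_inequality`), so a flat child forces a sharp angle in the parent
opposite the long base, and again a large parent. The resulting inequalities, by number of children
and type of parent, are `nonobtuse_add_one`, `nonobtuse_add_two`, `nonobtuse_add_three`,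
`obtuse_add_one` and `obtuse_add_two`. They say that a parent together with any nonempty set of its
children has average area at least 2.

The angle condition also shows that an obtuse parent never receives a child across its own longest
side. Passing to an obtuse parent therefore lengthens the longest side by a definite amount
(`IsChildAt.sideRank_lt`), and since sides are at most 2R, chains end at non-obtuse triangles. To
make the groups disjoint, a kernel N of this well-founded relation is taken
(`WellFounded.exists_kernel`): triangles in N join their parents, and every other triangle heads a
group.

Groups have bounded diameter, so a large disc cuts only linearly many of them in its radius, against
quadratically many triangles; this gives the average bound. For sharpness, a non-obtuse triangle
generates a lattice whose triangulation by copies of it is Delone (`exists_lattice_system`). -/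

theorem area_bounds_of_obtuse {l m n A : ℝ} (hm : 4 ≤ m) (hn : 4 ≤ n) (hl : m + n ≤ l)
    (hA : 0 ≤ A) (heron : 16 * A ^ 2 = 4 * m * n - (l - m - n) ^ 2)
    (hrad : m * n * l ≤ 128 * A ^ 2) :
    8 ≤ l ∧ 1 ≤ A ∧ 64 - (l - 8) ^ 2 ≤ 16 * A ^ 2 := by
  have hmn : 16 ≤ m * n := by nlinarith
  -- The last bound inserts 4mn ≥ 64 and 0 ≤ l - m - n ≤ l - 8 into Heron's formula; A ≥ 1 comes
  -- from the circumradius bound and mnl ≥ 128.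
  refine ⟨by linarith, ?_, by nlinarith⟩
  have : 128 ≤ m * n * l := by nlinarith
  nlinarith

/-- Here l - m - n is -4A times the cotangent of the obtuse angle, and k will be 4S times the
cotangent of the parent's opposite angle. `hD` then says that the cotangents have nonnegative sum,
and it replaces the unknown l - m - n in Heron's formula by a quantity of the parent. -/
theorem cot_bound_of_obtuse {l m n A S k : ℝ} (hm : 4 ≤ m) (hn : 4 ≤ n) (hl : m + n ≤ l)
    (hS : 0 ≤ S) (heron : 16 * A ^ 2 = 4 * m * n - (l - m - n) ^ 2)
    (hD : (l - m - n) * S ≤ k * A) :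
    64 * S ^ 2 ≤ 16 * A ^ 2 * S ^ 2 + (k * A) ^ 2 := by
  have hmn : 16 ≤ m * n := by nlinarith
  have h1 : 64 - (l - m - n) ^ 2 ≤ 16 * A ^ 2 := by nlinarith
  have h2 : ((l - m - n) * S) ^ 2 ≤ (k * A) ^ 2 :=
    pow_le_pow_left₀ (mul_nonneg (by linarith) hS) hD 2
  nlinarith [mul_le_mul_of_nonneg_right h1 (sq_nonneg S)]

/-- The difference 16S² - 2p(q + s - p) factors as (p + s - q)(p + q - s). It bounds the cotangent
of the angle facing p by 2S/p. -/
theorem two_mul_area_ge_of_nonobtuse {p q s S : ℝ}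
    (heron : 16 * S ^ 2 = 4 * q * s - (p - q - s) ^ 2) (h2 : q ≤ p + s) (h3 : s ≤ p + q) :
    p * (q + s - p) ≤ 8 * S ^ 2 := by
  nlinarith [mul_nonneg (sub_nonneg.2 h2) (sub_nonneg.2 h3)]

theorem area_add_ge_of_nonobtuse {p q s S A : ℝ} (hp : 8 ≤ p) (hq : 4 ≤ q) (hs : 4 ≤ s)
    (h1 : p ≤ q + s) (h2 : q ≤ p + s) (h3 : s ≤ p + q) (hS : 0 ≤ S)
    (heron : 16 * S ^ 2 = 4 * q * s - (p - q - s) ^ 2)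
    (hA1 : 1 ≤ A) (hA2 : 64 - (p - 8) ^ 2 ≤ 16 * A ^ 2) : 4 ≤ S + A := by
  by_contra! hcon
  have h8 := two_mul_area_ge_of_nonobtuse heron h2 h3
  have hS3 : S < 3 := by linarith
  have hk : q + s - p ≤ 16 := by nlinarith
  -- Equality holds for the right triangle with squared legs 4 and p - 4.
  have hS2 : p - 4 ≤ S ^ 2 := by nlinarith [mul_nonneg (sub_nonneg.2 hq) (sub_nonneg.2 hs)]
  have hp13 : p < 13 := by nlinarith
  -- With u = p - 8 in [0, 5], the chord 2 + u/5 lies below √(4 + u), and 2 - u/5 lies below √(64 -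
  -- u²)/4; the slopes cancel in the sum.
  have hSl : 2 + (p - 8) / 5 ≤ S := by
    refine (abs_le_of_sq_le_sq' ?_ hS).2
    nlinarith
  have hAl : 2 - (p - 8) / 5 ≤ A := by
    refine (abs_le_of_sq_le_sq' ?_ (by linarith)).2
    nlinarith
  linarith

/-- Bootstrapping by contradiction: a lower bound for S makes A small, which makes p large and, by
`hA3`, makes q + s - p a large multiple of S. Then p(q + s - p) ≤ 8S² forces S > 4, impossible with
A ≥ 1. -/
theorem area_add_two_mul_ge_of_nonobtuse {p q s S A : ℝ} (hp : 8 ≤ p) (hq : 8 ≤ q) (hs : 4 ≤ s)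
    (h1 : p ≤ q + s) (h2 : q ≤ p + s) (h3 : s ≤ p + q) (hS : 0 ≤ S)
    (heron : 16 * S ^ 2 = 4 * q * s - (p - q - s) ^ 2)
    (hA1 : 1 ≤ A) (hA2 : 64 - (p - 8) ^ 2 ≤ 16 * A ^ 2)
    (hA3 : 64 * S ^ 2 ≤ 16 * A ^ 2 * S ^ 2 + ((q + s - p) * A) ^ 2) : 6 ≤ S + 2 * A := by
  by_contra! hcon
  have h8 := two_mul_area_ge_of_nonobtuse heron h2 h3
  -- The extreme triangle has squared sides 8, 8, 4; the decimals below round √7 and its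
  -- consequences safely.
  have hS7 : 7 ≤ S ^ 2 := by
    nlinarith [mul_nonneg (sub_nonneg.2 hp) (sub_nonneg.2 hq),
      mul_nonneg (sub_nonneg.2 hp) (sub_nonneg.2 hs), mul_nonneg (sub_nonneg.2 hq) (sub_nonneg.2 hs),
      mul_nonneg (sub_nonneg.2 h1) (sub_nonneg.2 h2), mul_nonneg (sub_nonneg.2 h1) (sub_nonneg.2 h3),
      mul_nonneg (sub_nonneg.2 h2) (sub_nonneg.2 h3)]
  have hSl : 2.645 < S := by nlinarith
  have hAu : A ^ 2 < 2.815 := by nlinarith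
  have hpl : 12.35 ≤ p := by nlinarith
  have hk : (2.594 * S) ^ 2 ≤ (q + s - p) ^ 2 := by
    have h5 : 64 * S ^ 2 ≤ 2.815 * (16 * S ^ 2 + (q + s - p) ^ 2) := by
      nlinarith [mul_nonneg (sub_nonneg.2 hAu.le) (sq_nonneg S),
        mul_nonneg (sub_nonneg.2 hAu.le) (sq_nonneg (q + s - p))]
    nlinarith
  have hk' : 2.594 * S ≤ q + s - p := (abs_le_of_sq_le_sq' hk (by linarith)).2
  nlinarith

theorem area_add_three_mul_ge_of_nonobtuse {p q s S A : ℝ} (hp : 8 ≤ p) (hq : 8 ≤ q) (hs : 8 ≤ s)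
    (h1 : p ≤ q + s) (h2 : q ≤ p + s) (h3 : s ≤ p + q) (hS : 0 ≤ S)
    (heron : 16 * S ^ 2 = 4 * q * s - (p - q - s) ^ 2)
    (hA1 : 1 ≤ A) (hA2 : 64 - (p - 8) ^ 2 ≤ 16 * A ^ 2)
    (hA3 : 64 * S ^ 2 ≤ 16 * A ^ 2 * S ^ 2 + ((q + s - p) * A) ^ 2) : 8 ≤ S + 3 * A := by
  by_contra! hcon
  have h8 := two_mul_area_ge_of_nonobtuse heron h2 h3
  -- The extreme triangle is equilateral with squared side 8. The bootstrapping is as for two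
  -- children and ends with S > 5, against A ≥ 1.
  have hS7 : 12 ≤ S ^ 2 := by
    nlinarith [mul_nonneg (sub_nonneg.2 hp) (sub_nonneg.2 hq),
      mul_nonneg (sub_nonneg.2 hp) (sub_nonneg.2 hs), mul_nonneg (sub_nonneg.2 hq) (sub_nonneg.2 hs),
      mul_nonneg (sub_nonneg.2 h1) (sub_nonneg.2 h2), mul_nonneg (sub_nonneg.2 h1) (sub_nonneg.2 h3),
      mul_nonneg (sub_nonneg.2 h2) (sub_nonneg.2 h3)]
  have hSl : 3.46 < S := by nlinarith
  have hAu : A ^ 2 < 2.31 := by nlinarith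
  have hpl : 13 ≤ p := by nlinarith
  have hk : (3.4 * S) ^ 2 ≤ (q + s - p) ^ 2 := by
    have h5 : 64 * S ^ 2 ≤ 2.31 * (16 * S ^ 2 + (q + s - p) ^ 2) := by
      nlinarith [mul_nonneg (sub_nonneg.2 hAu.le) (sq_nonneg S),
        mul_nonneg (sub_nonneg.2 hAu.le) (sq_nonneg (q + s - p))]
    nlinarith
  have hk' : 3.4 * S ≤ q + s - p := (abs_le_of_sq_le_sq' hk (by linarith)).2
  nlinarith

/-- If 16S² were below M, Heron's formula would force the excess v of the longest squared side over
p + q to be at least w; the product of the squared sides would then exceed 128S². The parameters P,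
M, w are free for numerical use. -/
theorem area_sq_ge_of_obtuse {p q v S P M : ℝ} (hq : 4 ≤ q) (hv : 0 ≤ v) (hP : 0 ≤ P)
    (hp : P ≤ p) (heron : 16 * S ^ 2 = 4 * p * q - v ^ 2)
    (hrad : p * q * (p + q + v) ≤ 128 * S ^ 2) {w : ℝ} (hw : 0 ≤ w) (hwM : w ^ 2 ≤ 16 * P - M)
    (hPM : 8 * M ≤ 4 * P * (4 + P + w)) : M ≤ 16 * S ^ 2 := by
  by_contra! hcon
  have hpq : 4 * P ≤ p * q := by nlinarith
  have hvw : w ≤ v := by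
    refine (abs_le_of_sq_le_sq' ?_ hv).2
    nlinarith
  have : 4 * P * (4 + P + w) ≤ p * q * (p + q + v) :=
    mul_le_mul hpq (by linarith) (by positivity) (by nlinarith)
  linarith

theorem area_add_ge_of_obtuse {p q s S A : ℝ} (hp : 8 ≤ p) (hq : 4 ≤ q)
    (h1 : p + q ≤ s) (hS : 0 ≤ S)
    (heron : 16 * S ^ 2 = 4 * p * q - (s - p - q) ^ 2)
    (hrad : p * q * s ≤ 128 * S ^ 2)
    (hA1 : 1 ≤ A) (hA2 : 64 - (p - 8) ^ 2 ≤ 16 * A ^ 2) : 4 ≤ S + A := by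
  have hv : 0 ≤ s - p - q := by linarith
  have hrad' : p * q * (p + q + (s - p - q)) ≤ 128 * S ^ 2 := by
    rw [show p + q + (s - p - q) = s by ring]; exact hrad
  have key := fun (P M w : ℝ) hP hp hw hwM hPM =>
    area_sq_ge_of_obtuse (P := P) (M := M) (w := w) hq hv hP hp heron hrad' hw hwM hPM
  -- On each of three ranges of p the area S is bounded from the left endpoint and A from the right
  -- one; for p ≥ 12.5, S ≥ 3 and A ≥ 1 suffice.
  rcases le_or_gt 12.5 p with h | h
  · have := key 12.5 144 7.48 (by norm_num) h (by norm_num) (by norm_num) (by norm_num)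
    nlinarith
  rcases le_or_gt 9 p with h' | h'
  · have := key 9 88.3 7.46 (by norm_num) h' (by norm_num) (by norm_num) (by norm_num)
    have hA : 1.652 ≤ A := by nlinarith
    nlinarith
  · have := key 8 66 7.87 (by norm_num) hp (by norm_num) (by norm_num) (by norm_num)
    have hA : 1.984 ≤ A := by nlinarith
    nlinarith

/-- With both short squared sides at least 8 the circumradius bound alone gives S² ≥ 8. It also
bounds p in terms of S < 4, which keeps A above 1.65. -/
theorem area_add_two_mul_ge_of_obtuse {p q s S A : ℝ} (hp : 8 ≤ p) (hq : 8 ≤ q)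
    (h1 : p + q ≤ s) (hS : 0 ≤ S)
    (hrad : p * q * s ≤ 128 * S ^ 2)
    (hA1 : 1 ≤ A) (hA2 : 64 - (p - 8) ^ 2 ≤ 16 * A ^ 2) : 6 ≤ S + 2 * A := by
  by_contra! hcon
  have hpq : p * 8 ≤ p * q := by nlinarith
  have h2 : p * 8 * (p + 8) ≤ p * q * s :=
    mul_le_mul hpq (by linarith) (by linarith) (by nlinarith)
  have hS8 : 8 ≤ S ^ 2 := by nlinarith
  have hS4 : S < 4 := by linarith
  have hp2 : p < 12.5 := by nlinarith
  have : 1.65 ≤ A := by nlinarith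
  nlinarith

/-! ### Triangles in coordinates -/

/-- Twice the signed area of the triangle `A B C`. -/
noncomputable def cross (A B C : Plane) : ℝ :=
  (B 0 - A 0) * (C 1 - A 1) - (B 1 - A 1) * (C 0 - A 0)

/-- The scalar product of `A - C` and `B - C`. -/
noncomputable def scal (A B C : Plane) : ℝ :=
  (A 0 - C 0) * (B 0 - C 0) + (A 1 - C 1) * (B 1 - C 1)

theorem plane_ext {X Y : Plane} (h0 : X 0 = Y 0) (h1 : X 1 = Y 1) : X = Y := by
  ext i; fin_cases i <;> assumption

theorem dist_sq_eq (A B : Plane) : dist A B ^ 2 = (A 0 - B 0) ^ 2 + (A 1 - B 1) ^ 2 := by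
  rw [EuclideanSpace.dist_sq_eq]
  simp [Fin.sum_univ_two, Real.dist_eq, sq_abs]

/-- No distinctness is needed: if A or B equals C, the angle is π/2 and the scalar product 0, so
both sides fail. -/
theorem pi_div_two_lt_angle_iff (A B C : Plane) :
    Real.pi / 2 < EuclideanGeometry.angle A C B ↔ scal A B C < 0 := by
  have hs : inner ℝ (A - C) (B - C) = scal A B C := by
    simp [PiLp.inner_apply, Fin.sum_univ_two, scal]; ring
  rw [EuclideanGeometry.angle, vsub_eq_sub, vsub_eq_sub, ← hs, ← not_le, ← not_le,
    not_iff_not, InnerProductGeometry.angle, Real.arccos_le_pi_div_two]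
  constructor
  · intro h
    rw [← InnerProductGeometry.cos_angle_mul_norm_mul_norm, InnerProductGeometry.cos_angle]
    positivity
  · intro h
    positivity

theorem mem_region_iff {A B C X : Plane} :
    X ∈ region {A, B, C} ↔ ∃ a b c : ℝ, 0 ≤ a ∧ 0 ≤ b ∧ 0 ≤ c ∧ a + b + c = 1 ∧
      X 0 = a * A 0 + b * B 0 + c * C 0 ∧ X 1 = a * A 1 + b * B 1 + c * C 1 := by
  rw [region, Finset.coe_insert, Finset.coe_pair,
    convexHull_insert (Set.insert_nonempty _ _), convexHull_pair]
  constructor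
  · rw [mem_convexJoin]
    rintro ⟨A', rfl, Y, ⟨b, c, hb, hc, hbc, rfl⟩, ⟨a, d, ha, hd, had, rfl⟩⟩
    refine ⟨a, d * b, d * c, ha, by positivity, by positivity,
      by rw [add_assoc, ← mul_add, hbc, mul_one, had], ?_, ?_⟩ <;>
      simp <;> ring
  · rintro ⟨a, b, c, ha, hb, hc, habc, h0, h1⟩
    rw [mem_convexJoin]
    rcases (add_nonneg hb hc).eq_or_lt with h | h
    · have hb0 : b = 0 := by linarith
      have hc0 : c = 0 := by linarith
      subst hb0 hc0
      refine ⟨A, rfl, B, left_mem_segment _ _ _, ?_⟩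
      have : X = A := plane_ext (by rw [h0]; linear_combination A 0 * habc)
        (by rw [h1]; linear_combination A 1 * habc)
      rw [this]; exact left_mem_segment _ _ _
    · refine ⟨A, rfl, (b / (b + c)) • B + (c / (b + c)) • C,
        ⟨_, _, by positivity, by positivity, by field_simp, rfl⟩, a, b + c, ha, h.le, by linarith, ?_⟩
      apply plane_ext
      · rw [h0]; simp; field_simp; ring
      · rw [h1]; simp; field_simp; ring

theorem collinear_iff_cross (A B C : Plane) : Collinear ℝ {A, B, C} ↔ cross A B C = 0 := by
  constructor
  · intro h
    obtain ⟨v, hv⟩ := (collinear_iff_of_mem (p₀ := A) (by simp)).1 h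
    obtain ⟨b, hb⟩ := hv B (by simp)
    obtain ⟨c, hc⟩ := hv C (by simp)
    rw [hb, hc]; simp [cross]; ring
  · intro h
    by_cases hAB : A = B
    · subst hAB
      simpa using collinear_pair ℝ A C
    rw [collinear_iff_of_mem (p₀ := A) (by simp)]
    have hd : 0 < (B 0 - A 0) ^ 2 + (B 1 - A 1) ^ 2 := by
      rw [← dist_sq_eq]
      have := dist_pos.2 (Ne.symm hAB)
      positivity
    refine ⟨B - A, ?_⟩
    rintro P (rfl | rfl | rfl)
    · exact ⟨0, by simp⟩
    · exact ⟨1, by simp⟩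
    · refine ⟨((P 0 - A 0) * (B 0 - A 0) + (P 1 - A 1) * (B 1 - A 1)) /
        ((B 0 - A 0) ^ 2 + (B 1 - A 1) ^ 2), ?_⟩
      rw [cross] at h
      apply plane_ext
      · simp; field_simp; linear_combination (-(B 1 - A 1)) * h
      · simp; field_simp; linear_combination (B 0 - A 0) * h

theorem ne_of_cross_ne_zero {A B C : Plane} (h : cross A B C ≠ 0) : A ≠ B ∧ A ≠ C ∧ B ≠ C := by
  refine ⟨?_, ?_, ?_⟩ <;> rintro rfl <;> apply h <;> (simp [cross]; try ring)

theorem isTriangle_iff {A B C : Plane} : IsTriangle {A, B, C} ↔ cross A B C ≠ 0 := by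
  rw [Ne, ← collinear_iff_cross, ← affineIndependent_iff_not_collinear_set]
  have hr : Set.range ![A, B, C] = (({A, B, C} : Finset Plane) : Set Plane) := by
    simp [Matrix.range_cons, Matrix.range_empty]
    ext; simp; tauto
  constructor
  · rintro ⟨h3, h⟩
    have hAB : A ≠ B := by
      rintro rfl
      have := Finset.card_le_two (a := A) (b := C)
      simp only [Finset.mem_insert, Finset.mem_singleton, true_or, Finset.insert_eq_of_mem] at h3
      omega
    have hAC : A ≠ C := by
      rintro rfl
      have := Finset.card_le_two (a := B) (b := A)
      simp only [Finset.mem_insert, Finset.mem_singleton, or_true, Finset.insert_eq_of_mem] at h3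
      omega
    have hBC : B ≠ C := by
      rintro rfl
      have := Finset.card_le_two (a := A) (b := B)
      simp only [Finset.mem_singleton, Finset.insert_eq_of_mem] at h3
      omega
    have hinj : Function.Injective ![A, B, C] := by
      intro i j hij
      fin_cases i <;> fin_cases j <;> simp_all
    apply AffineIndependent.of_set_of_injective _ hinj
    rw [hr]; exact h
  · intro h
    have h' := h.range
    rw [hr] at h'
    refine ⟨?_, h'⟩
    have hc := (affineIndependent_iff_not_collinear_set.1 h)
    rw [collinear_iff_cross] at hc
    obtain ⟨h1, h2, h3⟩ := ne_of_cross_ne_zero hc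
    exact Finset.card_eq_three.2 ⟨A, B, C, h1, h2, h3, rfl⟩

theorem IsTriangle.exists_eq {t : Finset Plane} (h : IsTriangle t) :
    ∃ A B C, t = {A, B, C} ∧ cross A B C ≠ 0 := by
  obtain ⟨A, B, C, -, -, -, rfl⟩ := Finset.card_eq_three.1 h.1
  exact ⟨A, B, C, rfl, isTriangle_iff.1 h⟩

theorem volume_standard_triangle :
    volume {X : Plane | 0 ≤ X 0 ∧ 0 ≤ X 1 ∧ X 0 + X 1 ≤ 1} = ENNReal.ofReal (1 / 2) := by
  have h1 := (volume_preserving_finTwoArrow ℝ).comp (PiLp.volume_preserving_ofLp (Fin 2))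
  have hm : MeasurableSet {x : ℝ × ℝ | 0 ≤ x.1 ∧ 0 ≤ x.2 ∧ x.1 + x.2 ≤ 1} := by
    measurability
  have h2 : volume {x : ℝ × ℝ | 0 ≤ x.1 ∧ 0 ≤ x.2 ∧ x.1 + x.2 ≤ 1} = ENNReal.ofReal (1 / 2) := by
    have hslice : ∀ x : ℝ, volume (Prod.mk x ⁻¹' {x : ℝ × ℝ | 0 ≤ x.1 ∧ 0 ≤ x.2 ∧ x.1 + x.2 ≤ 1}) =
        (Set.Icc (0 : ℝ) 1).indicator (fun x => ENNReal.ofReal (1 - x)) x := by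
      intro x
      by_cases hx : 0 ≤ x
      · have : Prod.mk x ⁻¹' {x : ℝ × ℝ | 0 ≤ x.1 ∧ 0 ≤ x.2 ∧ x.1 + x.2 ≤ 1} =
            Set.Icc 0 (1 - x) := by
          ext y; simp [hx, le_sub_iff_add_le']
        rw [this, Real.volume_Icc, sub_zero, Set.indicator]
        split_ifs with h
        · rfl
        · rw [ENNReal.ofReal_eq_zero, sub_nonpos]
          by_contra! h'
          exact h ⟨hx, h'.le⟩
      · simp [hx]
    rw [Measure.volume_eq_prod, Measure.prod_apply hm, lintegral_congr hslice,
      lintegral_indicator measurableSet_Icc, ← ofReal_integral_eq_lintegral_ofReal]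
    · rw [integral_Icc_eq_integral_Ioc, ← intervalIntegral.integral_of_le zero_le_one]
      rw [intervalIntegral.integral_sub (by simp) (by simp), integral_id]
      norm_num
    · exact Continuous.integrableOn_Icc (by fun_prop)
    · exact (ae_restrict_iff' measurableSet_Icc).2 (Filter.Eventually.of_forall
        fun x hx => by simpa using hx.2)
  rw [← h2, ← h1.measure_preimage hm.nullMeasurableSet]
  rfl

theorem area_eq (A B C : Plane) : area {A, B, C} = |cross A B C| / 2 := by
  let M : Matrix (Fin 2) (Fin 2) ℝ := !![B 0 - A 0, C 0 - A 0; B 1 - A 1, C 1 - A 1]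
  let f : Plane →ₗ[ℝ] Plane := Matrix.toLpLin 2 2 M
  have hdet : LinearMap.det f = cross A B C := by
    simp only [f, Matrix.toLpLin_eq_toLin, LinearMap.det_toLin, M, Matrix.det_fin_two_of, cross]
    ring
  have hf0 : ∀ X, f X 0 = (B 0 - A 0) * X 0 + (C 0 - A 0) * X 1 := by
    intro X; simp [f, M, Matrix.toLpLin_apply, dotProduct, Fin.sum_univ_two]
  have hf1 : ∀ X, f X 1 = (B 1 - A 1) * X 0 + (C 1 - A 1) * X 1 := by
    intro X; simp [f, M, Matrix.toLpLin_apply, dotProduct, Fin.sum_univ_two]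
  have himg : region {A, B, C} =
      (fun X => A + X) '' (f '' {X : Plane | 0 ≤ X 0 ∧ 0 ≤ X 1 ∧ X 0 + X 1 ≤ 1}) := by
    ext X
    rw [mem_region_iff]
    constructor
    · rintro ⟨a, b, c, ha, hb, hc, habc, h0, h1⟩
      refine ⟨_, ⟨!₂[b, c], ⟨by simpa using hb, by simpa using hc, by simp; linarith⟩, rfl⟩, ?_⟩
      apply plane_ext
      · simp [hf0, h0]; linear_combination (-A 0) * habc
      · simp [hf1, h1]; linear_combination (-A 1) * habc
    · rintro ⟨_, ⟨Y, ⟨hY0, hY1, hY⟩, rfl⟩, rfl⟩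
      refine ⟨1 - Y 0 - Y 1, Y 0, Y 1, by linarith, hY0, hY1, by ring, ?_, ?_⟩
      · simp [hf0]; ring
      · simp [hf1]; ring
  rw [area, himg, Set.image_add_left, measure_preimage_add, Measure.addHaar_image_linearMap, hdet,
    volume_standard_triangle, ← ENNReal.ofReal_mul (abs_nonneg _),
    ENNReal.toReal_ofReal (by positivity)]
  ring

theorem scal_eq (A B C : Plane) :
    2 * scal A B C = dist A C ^ 2 + dist B C ^ 2 - dist A B ^ 2 := by
  simp only [dist_sq_eq, scal]; ring

theorem scal_comm (A B C : Plane) : scal A B C = scal B A C := by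
  simp only [scal]; ring

theorem isObtuse_iff {A B C : Plane} :
    IsObtuse {A, B, C} ↔ scal B C A < 0 ∨ scal A C B < 0 ∨ scal A B C < 0 := by
  have hself : ∀ X Y : Plane, ¬ scal X X Y < 0 := fun X Y => by
    rw [not_lt, scal]; nlinarith [mul_self_nonneg (X 0 - Y 0), mul_self_nonneg (X 1 - Y 1)]
  have hl : ∀ X Y : Plane, ¬ scal X Y X < 0 := fun X Y => by simp [scal]
  have hr : ∀ X Y : Plane, ¬ scal Y X X < 0 := fun X Y => by simp [scal]
  simp only [IsObtuse, pi_div_two_lt_angle_iff, Finset.mem_insert, Finset.mem_singleton,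
    exists_eq_or_imp, exists_eq_left, hself, hl, hr, false_or, or_false]
  rw [scal_comm B A C, scal_comm C A B, scal_comm C B A]
  tauto

theorem heron (A B C : Plane) : 16 * area {A, B, C} ^ 2 =
    4 * dist A C ^ 2 * dist A B ^ 2 - (dist B C ^ 2 - dist A C ^ 2 - dist A B ^ 2) ^ 2 := by
  rw [area_eq, div_pow, sq_abs]
  simp only [dist_sq_eq, cross]; ring

theorem circumradius_identity {A B C o : Plane} {ρ : ℝ} (hA : dist A o = ρ) (hB : dist B o = ρ)
    (hC : dist C o = ρ) : 16 * ρ ^ 2 * area {A, B, C} ^ 2 =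
      dist B C ^ 2 * dist A C ^ 2 * dist A B ^ 2 := by
  have hA := congrArg (· ^ 2) hA
  have hB := congrArg (· ^ 2) hB
  have hC := congrArg (· ^ 2) hC
  simp only [dist_sq_eq] at hA hB hC
  rw [area_eq, div_pow, sq_abs]
  -- Cramer's rule for the circumcentre, from the differences of the three circle equations.
  have h0 : 2 * cross A B C * (o 0 - A 0) =
      ((B 0 - A 0) ^ 2 + (B 1 - A 1) ^ 2) * (C 1 - A 1) -
        ((C 0 - A 0) ^ 2 + (C 1 - A 1) ^ 2) * (B 1 - A 1) := by
    rw [cross]; linear_combination (C 1 - A 1) * (hA - hB) - (B 1 - A 1) * (hA - hC)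
  have h1 : 2 * cross A B C * (o 1 - A 1) =
      ((C 0 - A 0) ^ 2 + (C 1 - A 1) ^ 2) * (B 0 - A 0) -
        ((B 0 - A 0) ^ 2 + (B 1 - A 1) ^ 2) * (C 0 - A 0) := by
    rw [cross]; linear_combination (B 0 - A 0) * (hA - hC) - (C 0 - A 0) * (hA - hB)
  have h2 : 4 * cross A B C ^ 2 * ρ ^ 2 =
      (((B 0 - A 0) ^ 2 + (B 1 - A 1) ^ 2) * (C 1 - A 1) -
        ((C 0 - A 0) ^ 2 + (C 1 - A 1) ^ 2) * (B 1 - A 1)) ^ 2 +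
      (((C 0 - A 0) ^ 2 + (C 1 - A 1) ^ 2) * (B 0 - A 0) -
        ((B 0 - A 0) ^ 2 + (B 1 - A 1) ^ 2) * (C 0 - A 0)) ^ 2 := by
    rw [← h0, ← h1]; linear_combination (-4 * cross A B C ^ 2) * hA
  simp only [dist_sq_eq]
  linear_combination h2

/-- For two triangles on different sides of `AB` with `Q` not inside the circumcircle of `ABP`,
the sum of the angles at `P` and `Q` is at most `π`. -/
theorem delone_inequality {A B P Q o : Plane} {ρ : ℝ} (hA : dist A o = ρ) (hB : dist B o = ρ)
    (hP : dist P o = ρ) (hQ : ρ ≤ dist Q o) (hside : cross A B P * cross A B Q < 0) :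
    0 ≤ scal A B P * |cross A B Q| + scal A B Q * |cross A B P| := by
  have hQ' : ρ ^ 2 ≤ dist Q o ^ 2 := pow_le_pow_left₀ (hA ▸ dist_nonneg) hQ 2
  have hA := congrArg (· ^ 2) hA
  have hB := congrArg (· ^ 2) hB
  have hP := congrArg (· ^ 2) hP
  simp only [dist_sq_eq] at hA hB hP hQ'
  have key : 0 ≤ (scal A B Q * cross A B P - scal A B P * cross A B Q) * cross A B P := by
    -- The first factor is the in-circle determinant: it equals the power of Q with respect to the
    -- circle times `cross A B P`.
    have : (scal A B Q * cross A B P - scal A B P * cross A B Q) * cross A B P =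
      ((Q 0 - o 0) ^ 2 + (Q 1 - o 1) ^ 2 - ρ ^ 2) * cross A B P ^ 2 := by
      linear_combination (norm := skip) (cross A B P * (-cross Q B P)) * hA +
        (cross A B P * (-cross A Q P)) * hB +
        (cross A B P * (-cross A B Q)) * hP
      unfold scal cross
      ring
    rw [this]
    exact mul_nonneg (by linarith) (sq_nonneg _)
  rcases lt_trichotomy (cross A B P) 0 with h | h | h
  · have h' : 0 < cross A B Q := by nlinarith
    rw [abs_of_neg h, abs_of_pos h']
    nlinarith
  · simp [h] at hside
  · have h' : cross A B Q < 0 := by nlinarith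
    rw [abs_of_pos h, abs_of_neg h']
    nlinarith

/-! ### `(r,R)`-systems and their Delone triangulations -/

theorem IsRRSystem.two_mul_le_dist {r R : ℝ} {P : Set Plane} (hP : IsRRSystem r R P) {p q : Plane}
    (hp : p ∈ P) (hq : q ∈ P) (hpq : p ≠ q) : 2 * r ≤ dist p q := by
  by_contra! h
  have hd := hP.packing hp hq hpq
  refine Set.disjoint_left.1 hd (?_ : midpoint ℝ p q ∈ _) ?_
  · rw [Metric.mem_ball, dist_midpoint_left]; norm_num; linarith
  · rw [Metric.mem_ball, dist_midpoint_right]; norm_num; linarith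

/-- Finitely many balls of radius r cover the disc, and each contains at most one point of P. -/
theorem IsRRSystem.finite_inter_closedBall {r R : ℝ} {P : Set Plane} (hP : IsRRSystem r R P)
    (x : Plane) (ρ : ℝ) : (P ∩ Metric.closedBall x ρ).Finite := by
  obtain ⟨t, ht, hcov⟩ := Metric.totallyBounded_iff.1
    (isCompact_closedBall x ρ).totallyBounded r hP.r_pos
  refine (ht.biUnion (t := fun y => P ∩ Metric.ball y r) fun y _ => ?_).subset ?_
  · refine Set.Subsingleton.finite fun p hp q hq => ?_
    by_contra hpq
    have h1 := hP.two_mul_le_dist hp.1 hq.1 hpq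
    have h2 := dist_triangle_right p q y
    have h3 := Metric.mem_ball.1 hp.2
    have h4 := Metric.mem_ball.1 hq.2
    linarith
  · rintro p ⟨hp, hpx⟩
    obtain ⟨y, hy, hpy⟩ := Set.mem_iUnion₂.1 (hcov hpx)
    exact Set.mem_iUnion₂.2 ⟨y, hy, hp, hpy⟩

theorem isCompact_region (t : Finset Plane) : IsCompact (region t) :=
  t.finite_toSet.isCompact_convexHull ℝ

theorem cross_of_mem_region {A B C X : Plane} (h : X ∈ region {A, B, C}) :
    ∃ c, 0 ≤ c ∧ c ≤ 1 ∧ cross A B X = c * cross A B C := by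
  obtain ⟨a, b, c, ha, hb, hc, habc, h0, h1⟩ := mem_region_iff.1 h
  refine ⟨c, hc, by linarith, ?_⟩
  have : a = 1 - b - c := by linarith
  rw [cross, h0, h1, this, cross]; ring

theorem cross_eq_zero_of_mem_convexHull_pair {A B X : Plane} {s : Set Plane} (hs : s ⊆ {A, B})
    (h : X ∈ convexHull ℝ s) : cross A B X = 0 := by
  have h' := convexHull_mono hs h
  rw [convexHull_pair] at h'
  obtain ⟨a, b, -, -, hab, rfl⟩ := h'
  have : a = 1 - b := by linarith
  rw [cross, this]; simp; ring

theorem eq_triple_of_mem {T : Finset Plane} (hT : T.card = 3) {A B : Plane} (hA : A ∈ T)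
    (hB : B ∈ T) (hAB : A ≠ B) : ∃ D, D ≠ A ∧ D ≠ B ∧ T = {A, B, D} := by
  have h1 : ((T.erase A).erase B).card = 1 := by
    rw [Finset.card_erase_of_mem (Finset.mem_erase.2 ⟨hAB.symm, hB⟩), Finset.card_erase_of_mem hA, hT]
  obtain ⟨D, hD⟩ := Finset.card_eq_one.1 h1
  have hD' : D ∈ (T.erase A).erase B := by simp [hD]
  simp only [Finset.mem_erase] at hD'
  refine ⟨D, hD'.2.1, hD'.1, ?_⟩
  rw [← hD, Finset.insert_erase (Finset.mem_erase.2 ⟨hAB.symm, hB⟩), Finset.insert_erase hA]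

section
variable {r R : ℝ} {P : Set Plane} {𝒯 : Set (Finset Plane)}

/-- The circumcentre is within R of some point of P, and no point of P is closer to it than ρ; hence
ρ ≤ R. -/
theorem IsDeloneTriangulation.exists_circumcircle (hP : IsRRSystem r R P)
    (h : IsDeloneTriangulation P 𝒯) {t : Finset Plane} (ht : t ∈ 𝒯) :
    ∃ (o : Plane) (ρ : ℝ), (∀ p ∈ t, dist p o = ρ) ∧ (∀ p ∈ P, ρ ≤ dist p o) ∧ 0 ≤ ρ ∧ ρ ≤ R := by
  obtain ⟨o, ρ, h1, h2⟩ := h.empty_circle t ht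
  obtain ⟨A, B, C, rfl, -⟩ := (h.isTriangle t ht).exists_eq
  refine ⟨o, ρ, h1, h2, by rw [← h1 A (by simp)]; exact dist_nonneg, ?_⟩
  have : o ∈ ⋃ p ∈ P, Metric.closedBall p R := by rw [hP.covering]; trivial
  obtain ⟨p, hp, hpo⟩ := Set.mem_iUnion₂.1 this
  rw [Metric.mem_closedBall, dist_comm] at hpo
  exact (h2 p hp).trans hpo

theorem IsDeloneTriangulation.exists_region_subset (hP : IsRRSystem r R P)
    (h : IsDeloneTriangulation P 𝒯) {t : Finset Plane} (ht : t ∈ 𝒯) :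
    ∃ o : Plane, region t ⊆ Metric.closedBall o R := by
  obtain ⟨o, ρ, h1, -, -, h2⟩ := h.exists_circumcircle hP ht
  refine ⟨o, convexHull_min (fun p hp => ?_) (convex_closedBall o R)⟩
  rw [Metric.mem_closedBall, h1 p hp]; exact h2

theorem IsDeloneTriangulation.dist_le (hP : IsRRSystem r R P)
    (h : IsDeloneTriangulation P 𝒯) {t : Finset Plane} (ht : t ∈ 𝒯) {X Y : Plane}
    (hX : X ∈ region t) (hY : Y ∈ region t) : dist X Y ≤ 2 * R := by
  obtain ⟨o, ho⟩ := h.exists_region_subset hP ht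
  have h1 := Metric.mem_closedBall.1 (ho hX)
  have h2 := Metric.mem_closedBall.1 (ho hY)
  linarith [dist_triangle_right X Y o]

theorem subset_region (t : Finset Plane) : (t : Set Plane) ⊆ region t := subset_convexHull ℝ _

theorem IsDeloneTriangulation.finite_meeting (hP : IsRRSystem r R P)
    (h : IsDeloneTriangulation P 𝒯) (x : Plane) (ρ : ℝ) :
    {t | t ∈ 𝒯 ∧ (region t ∩ Metric.closedBall x ρ).Nonempty}.Finite := by
  have hF := hP.finite_inter_closedBall x (ρ + 2 * R)
  refine (hF.toFinset.powerset.finite_toSet).subset ?_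
  rintro t ⟨ht, X, hX, hXx⟩
  simp only [Finset.mem_coe, Finset.mem_powerset]
  intro V hV
  rw [Set.Finite.mem_toFinset]
  refine ⟨h.vertices t ht hV, ?_⟩
  have h1 := h.dist_le hP ht (subset_region t hV) hX
  rw [Metric.mem_closedBall] at *
  linarith [dist_triangle V X x]

theorem IsDeloneTriangulation.exists_mem (h : IsDeloneTriangulation P 𝒯) (x : Plane) :
    ∃ t ∈ 𝒯, x ∈ region t := by
  have : x ∈ ⋃ t ∈ 𝒯, region t := by rw [h.cover]; trivial
  simpa using this

/-- Step from the midpoint M of AB slightly out of the triangle. By local finiteness a triangle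
containing the new point X also contains M, and the face-to-face property makes AB one of its sides.
-/
theorem IsDeloneTriangulation.exists_neighbour (hP : IsRRSystem r R P)
    (h : IsDeloneTriangulation P 𝒯) {A B C : Plane} (ht : {A, B, C} ∈ 𝒯) :
    ∃ D, {A, B, D} ∈ 𝒯 ∧ cross A B C * cross A B D < 0 := by
  have hc : cross A B C ≠ 0 := isTriangle_iff.1 (h.isTriangle _ ht)
  obtain ⟨hAB, hAC, hBC⟩ := ne_of_cross_ne_zero hc
  set M : Plane := (1 / 2 : ℝ) • A + (1 / 2 : ℝ) • B with hM
  -- The triangles near M that miss M: a finite union of compact sets, so a neighbourhood of M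
  -- avoids it.
  set U : Set Plane := ⋃ t ∈ {t | (t ∈ 𝒯 ∧ (region t ∩ Metric.closedBall M 1).Nonempty) ∧
    M ∉ region t}, region t with hU
  have hUc : IsClosed U := by
    refine Set.Finite.isClosed_biUnion ?_ fun t _ => (isCompact_region t).isClosed
    exact (h.finite_meeting hP M 1).subset fun t ht => ht.1
  have hMU : M ∉ U := by
    simp only [hU, Set.mem_iUnion, not_exists]
    exact fun t ht hMt => ht.2 hMt
  obtain ⟨δ, hδ, hball⟩ := Metric.isOpen_iff.1 hUc.isOpen_compl M hMU
  obtain ⟨ε, hε, hεδ, hε1⟩ : ∃ ε : ℝ, 0 < ε ∧ ε * dist M C < δ ∧ ε * dist M C ≤ 1 := by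
    refine ⟨min δ 1 / (dist M C + 1), by positivity, ?_, ?_⟩
    · rw [div_mul_eq_mul_div, div_lt_iff₀ (by positivity)]
      have := min_le_left δ 1
      have h0 : 0 < min δ 1 := by positivity
      nlinarith [dist_nonneg (x := M) (y := C)]
    · rw [div_mul_eq_mul_div, div_le_iff₀ (by positivity)]
      have := min_le_right δ 1
      have h0 : 0 < min δ 1 := by positivity
      nlinarith [dist_nonneg (x := M) (y := C)]
  set X : Plane := M + ε • (M - C) with hX
  have hXM : dist X M = ε * dist M C := by
    rw [hX, dist_eq_norm, add_sub_cancel_left, norm_smul, dist_eq_norm, Real.norm_of_nonneg hε.le]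
  have hXcross : cross A B X = - ε * cross A B C := by
    simp [hX, hM, cross]; ring
  obtain ⟨T, hT, hXT⟩ := h.exists_mem X
  have hMT : M ∈ region T := by
    by_contra hMT
    refine hball (Metric.mem_ball.2 (hXM ▸ hεδ)) ?_
    exact Set.mem_iUnion₂.2 ⟨T, ⟨⟨hT, X, hXT, Metric.mem_closedBall.2 (hXM ▸ hε1)⟩, hMT⟩, hXT⟩
  have hMt : M ∈ region {A, B, C} :=
    mem_region_iff.2 ⟨1 / 2, 1 / 2, 0, by norm_num, by norm_num, le_rfl, by norm_num,
      by simp [hM], by simp [hM]⟩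
  have hMi : M ∈ convexHull ℝ (((({A, B, C} : Finset Plane)) : Set Plane) ∩ (T : Set Plane)) := by
    rw [← h.face_to_face _ ht _ hT]; exact ⟨hMt, hMT⟩
  -- Otherwise M would be in the hull of B and C, but it is not on the line BC.
  have hAT : A ∈ T := by
    by_contra hA
    have := cross_eq_zero_of_mem_convexHull_pair (A := B) (B := C) (by
      rintro V ⟨hV, hVT⟩
      simp only [Finset.coe_insert, Finset.coe_singleton, Set.mem_insert_iff,
        Set.mem_singleton_iff] at hV ⊢
      rcases hV with rfl | hV
      · exact absurd hVT hA
      · exact hV) hMi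
    apply hc
    simp [hM, cross] at this
    rw [cross]; linarith
  have hBT : B ∈ T := by
    by_contra hB
    have := cross_eq_zero_of_mem_convexHull_pair (A := A) (B := C) (by
      rintro V ⟨hV, hVT⟩
      simp only [Finset.coe_insert, Finset.coe_singleton, Set.mem_insert_iff,
        Set.mem_singleton_iff] at hV ⊢
      rcases hV with rfl | rfl | rfl
      · exact Or.inl rfl
      · exact absurd hVT hB
      · exact Or.inr rfl) hMi
    apply hc
    simp [hM, cross] at this
    rw [cross]; linarith
  obtain ⟨D, -, -, rfl⟩ := eq_triple_of_mem (h.isTriangle T hT).1 hAT hBT hAB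
  refine ⟨D, hT, ?_⟩
  obtain ⟨d, hd0, -, hd⟩ := cross_of_mem_region hXT
  rw [hXcross] at hd
  have h1 : d * (cross A B C * cross A B D) < 0 := by
    have : d * (cross A B C * cross A B D) = - ε * cross A B C ^ 2 := by
      linear_combination (- cross A B C) * hd
    rw [this]
    have := sq_pos_of_ne_zero hc
    nlinarith
  by_contra! hcon
  have := mul_nonneg hd0 hcon
  linarith

/-- Otherwise the two triangles would overlap near the midpoint of AB, while the face-to-face
property confines their intersection to AB. -/
theorem IsDeloneTriangulation.eq_of_same_side (h : IsDeloneTriangulation P 𝒯) {A B C D : Plane}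
    (hC : {A, B, C} ∈ 𝒯) (hD : {A, B, D} ∈ 𝒯) (hside : 0 < cross A B C * cross A B D) : C = D := by
  have hc : cross A B C ≠ 0 := isTriangle_iff.1 (h.isTriangle _ hC)
  have hd : cross A B D ≠ 0 := isTriangle_iff.1 (h.isTriangle _ hD)
  obtain ⟨hAB, hAC, hBC⟩ := ne_of_cross_ne_zero hc
  by_contra hCD
  set α := cross C B D / cross A B D
  set β := cross A C D / cross A B D
  set γ := cross A B C / cross A B D with hγ
  have hγ0 : 0 < γ := by
    rw [hγ, ← mul_div_mul_right _ _ hd]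
    exact div_pos hside (mul_self_pos.2 hd)
  have hsum : α + β + γ = 1 := by
    simp only [α, β, γ]; field_simp; simp only [cross]; ring
  have e0 : C 0 = α * A 0 + β * B 0 + γ * D 0 := by
    simp only [α, β, γ]; field_simp; simp only [cross]; ring
  have e1 : C 1 = α * A 1 + β * B 1 + γ * D 1 := by
    simp only [α, β, γ]; field_simp; simp only [cross]; ring
  -- α, β, γ are the barycentric coordinates of C in ABD. This ε keeps the weights (1 - ε)/2 + εα
  -- and (1 - ε)/2 + εβ nonnegative.
  set ε : ℝ := 1 / (1 + 2 * |α| + 2 * |β|) with hε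
  have hden : 0 < 1 + 2 * |α| + 2 * |β| := by positivity
  have hε0 : 0 < ε := by positivity
  have hεmul : ε * (1 + 2 * |α| + 2 * |β|) = 1 := by rw [hε]; field_simp
  have hε1 : ε ≤ 1 := by nlinarith [abs_nonneg α, abs_nonneg β]
  set X : Plane := ((1 - ε) / 2) • A + ((1 - ε) / 2) • B + ε • C with hX
  have hX1 : X ∈ region {A, B, C} :=
    mem_region_iff.2 ⟨(1 - ε) / 2, (1 - ε) / 2, ε, by linarith, by linarith, hε0.le, by ring,
      by simp [hX], by simp [hX]⟩
  have hX2 : X ∈ region {A, B, D} := by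
    refine mem_region_iff.2 ⟨(1 - ε) / 2 + ε * α, (1 - ε) / 2 + ε * β, ε * γ, ?_, ?_, by positivity,
      by linear_combination ε * hsum, by simp [hX, e0]; ring, by simp [hX, e1]; ring⟩
    · nlinarith [neg_abs_le α, abs_nonneg β]
    · nlinarith [neg_abs_le β, abs_nonneg α]
  have hXi : X ∈ convexHull ℝ (((({A, B, C} : Finset Plane)) : Set Plane) ∩
      ((({A, B, D} : Finset Plane)) : Set Plane)) := by
    rw [← h.face_to_face _ hC _ hD]; exact ⟨hX1, hX2⟩
  have h0 := cross_eq_zero_of_mem_convexHull_pair (A := A) (B := B) (by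
      rintro V ⟨hV, hVT⟩
      simp only [Finset.coe_insert, Finset.coe_singleton, Set.mem_insert_iff,
        Set.mem_singleton_iff] at hV hVT ⊢
      rcases hV with rfl | rfl | rfl
      · exact Or.inl rfl
      · exact Or.inr rfl
      · tauto) hXi
  have h1 : cross A B X = ε * cross A B C := by
    simp [hX, cross]; ring
  rw [h1] at h0
  exact mul_ne_zero hε0.ne' hc h0

theorem volume_region_eq_zero_of_card_le_two {u : Finset Plane} (hu : u.card ≤ 2) :
    volume (convexHull ℝ (u : Set Plane)) = 0 := by
  obtain ⟨B, C, hBC⟩ : ∃ B C : Plane, u ⊆ {B, B, C} := by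
    obtain h | h | h : u.card = 0 ∨ u.card = 1 ∨ u.card = 2 := by omega
    · exact ⟨0, 0, by simp [Finset.card_eq_zero.1 h]⟩
    · obtain ⟨a, rfl⟩ := Finset.card_eq_one.1 h
      exact ⟨a, a, by simp⟩
    · obtain ⟨a, b, -, rfl⟩ := Finset.card_eq_two.1 h
      exact ⟨a, b, by simp⟩
  have h0 : area {B, B, C} = 0 := by rw [area_eq]; simp [cross]
  rw [area, ENNReal.toReal_eq_zero_iff] at h0
  have h1 : volume (region {B, B, C}) = 0 :=
    h0.resolve_right (isCompact_region _).measure_ne_top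
  exact measure_mono_null (convexHull_mono (Finset.coe_subset.2 hBC)) h1

theorem IsDeloneTriangulation.aedisjoint (h : IsDeloneTriangulation P 𝒯) {s t : Finset Plane}
    (hs : s ∈ 𝒯) (ht : t ∈ 𝒯) (hst : s ≠ t) : AEDisjoint volume (region s) (region t) := by
  rw [AEDisjoint, h.face_to_face s hs t ht, ← Finset.coe_inter]
  apply volume_region_eq_zero_of_card_le_two
  by_contra! hcon
  have h3 := (h.isTriangle s hs).1
  have h3' := (h.isTriangle t ht).1
  have e1 := Finset.eq_of_subset_of_card_le (Finset.inter_subset_left : s ∩ t ⊆ s) (by omega)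
  have e2 := Finset.eq_of_subset_of_card_le (Finset.inter_subset_right : s ∩ t ⊆ t) (by omega)
  exact hst (e1.symm.trans e2)

end

/-! ### Obtuse triangles and their neighbours across the longest side -/

/-- `t` is an obtuse triangle of `𝒯` whose longest side is the side of `T` opposite to its
vertex `X`. -/
def IsChildAt (𝒯 : Set (Finset Plane)) (t T : Finset Plane) (X : Plane) : Prop :=
  t ∈ 𝒯 ∧ T ∈ 𝒯 ∧ ∃ Y Z Q, T = {X, Y, Z} ∧ t = {Y, Z, Q} ∧ scal Y Z Q < 0 ∧
    cross Y Z Q * cross Y Z X < 0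

/-- The squared distance in units of `r ^ 2`. -/
noncomputable def sqDist (r : ℝ) (X Y : Plane) : ℝ := dist X Y ^ 2 / r ^ 2

/-- The area in units of `r ^ 2`. -/
noncomputable def relArea (r : ℝ) (t : Finset Plane) : ℝ := area t / r ^ 2

theorem sqDist_comm (r : ℝ) (X Y : Plane) : sqDist r X Y = sqDist r Y X := by
  rw [sqDist, dist_comm, sqDist]

theorem scal_div (r : ℝ) (A B C : Plane) :
    2 * (scal A B C / r ^ 2) = sqDist r A C + sqDist r B C - sqDist r A B := by
  simp only [sqDist]; rw [← mul_div_assoc, scal_eq]; ring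

theorem swap_triple (X Y Z : Plane) : ({X, Y, Z} : Finset Plane) = {X, Z, Y} := by
  rw [Finset.pair_comm]

theorem rotate_triple (X Y Z : Plane) : ({X, Y, Z} : Finset Plane) = {Y, Z, X} := by
  ext; simp; tauto

theorem cross_swap (A B C : Plane) : cross B A C = - cross A B C := by
  simp only [cross]; ring

theorem cross_rotate (A B C : Plane) : cross B C A = cross A B C := by
  simp only [cross]; ring

section
variable {r R : ℝ} {P : Set Plane} {𝒯 : Set (Finset Plane)} {t T : Finset Plane}

theorem IsDeloneTriangulation.cross_ne_zero (h : IsDeloneTriangulation P 𝒯) {X Y Z : Plane}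
    (ht : {X, Y, Z} ∈ 𝒯) : cross X Y Z ≠ 0 := isTriangle_iff.1 (h.isTriangle _ ht)

/-- The normalised data on which all area estimates rest: the packing, Heron's formula, and the
bound R² ≤ 8r² on squared circumradii. -/
theorem IsDeloneTriangulation.metric_bounds (hP : IsRRSystem r R P) (hR : R ^ 2 ≤ 8 * r ^ 2)
    (h : IsDeloneTriangulation P 𝒯) {X Y Z : Plane} (ht : {X, Y, Z} ∈ 𝒯) :
    4 ≤ sqDist r Y Z ∧ 4 ≤ sqDist r X Z ∧ 4 ≤ sqDist r X Y ∧ 0 < relArea r {X, Y, Z} ∧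
    16 * relArea r {X, Y, Z} ^ 2 = 4 * sqDist r X Z * sqDist r X Y -
      (sqDist r Y Z - sqDist r X Z - sqDist r X Y) ^ 2 ∧
    sqDist r Y Z * sqDist r X Z * sqDist r X Y ≤ 128 * relArea r {X, Y, Z} ^ 2 := by
  have hr := hP.r_pos
  have hc := h.cross_ne_zero ht
  obtain ⟨hXY, hXZ, hYZ⟩ := ne_of_cross_ne_zero hc
  have hv := h.vertices _ ht
  have hX : X ∈ P := hv (by simp)
  have hY : Y ∈ P := hv (by simp)
  have hZ : Z ∈ P := hv (by simp)
  have hside : ∀ {U V : Plane}, U ∈ P → V ∈ P → U ≠ V → 4 ≤ sqDist r U V := by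
    intro U V hU hV hUV
    rw [sqDist, le_div_iff₀ (by positivity)]
    have := pow_le_pow_left₀ (by positivity) (hP.two_mul_le_dist hU hV hUV) 2
    linarith
  refine ⟨hside hY hZ hYZ, hside hX hZ hXZ, hside hX hY hXY, ?_, ?_, ?_⟩
  · rw [relArea, area_eq]
    have := abs_pos.2 hc
    positivity
  · have := heron X Y Z
    simp only [relArea, sqDist]
    field_simp
    linear_combination this
  · obtain ⟨o, ρ, h1, h2, h3, h4⟩ := h.exists_circumcircle hP ht
    have := circumradius_identity (h1 X (by simp)) (h1 Y (by simp)) (h1 Z (by simp))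
    have hρ : ρ ^ 2 ≤ 8 * r ^ 2 := (pow_le_pow_left₀ h3 h4 2).trans hR
    simp only [relArea, sqDist]
    rw [div_mul_div_comm, div_mul_div_comm, ← this, div_pow, ← mul_div_assoc,
      div_le_div_iff₀ (by positivity) (by positivity)]
    have h5 := mul_le_mul_of_nonneg_right hρ
      (by positivity : 0 ≤ 16 * area {X, Y, Z} ^ 2 * (r ^ 2) ^ 2)
    linarith

theorem IsChildAt.exists_apex (h : IsDeloneTriangulation P 𝒯) {X Y Z : Plane}
    (hc : IsChildAt 𝒯 t {X, Y, Z} X) :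
    ∃ Q, t = {Y, Z, Q} ∧ scal Y Z Q < 0 ∧ cross Y Z Q * cross Y Z X < 0 := by
  obtain ⟨-, hT, Y', Z', Q, hE, rfl, hs, hcr⟩ := hc
  have h1 := ne_of_cross_ne_zero (h.cross_ne_zero hT)
  have h2 := ne_of_cross_ne_zero (h.cross_ne_zero (hE ▸ hT))
  have hY : Y ∈ ({X, Y', Z'} : Finset Plane) := by rw [← hE]; simp
  have hZ : Z ∈ ({X, Y', Z'} : Finset Plane) := by rw [← hE]; simp
  simp only [Finset.mem_insert, Finset.mem_singleton] at hY hZ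
  rcases hY with hY | rfl | rfl
  · exact absurd hY.symm h1.1
  · rcases hZ with hZ | hZ | rfl
    · exact absurd hZ.symm h1.2.1
    · exact absurd hZ.symm h1.2.2
    · exact ⟨Q, rfl, hs, hcr⟩
  · rcases hZ with hZ | rfl | hZ
    · exact absurd hZ.symm h1.2.1
    · refine ⟨Q, ?_, by rw [scal_comm]; exact hs, by rw [cross_swap, cross_swap Z Y X]; linarith⟩
      ext; simp; tauto
    · exact absurd hZ.symm h1.2.2

theorem IsChildAt.unique (h : IsDeloneTriangulation P 𝒯) {t' : Finset Plane} {X : Plane}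
    (hc : IsChildAt 𝒯 t T X) (hc' : IsChildAt 𝒯 t' T X) : t = t' := by
  obtain ⟨ht, hT, Y, Z, Q, rfl, rfl, hs, hcr⟩ := hc
  obtain ⟨Q', rfl, -, hcr'⟩ := hc'.exists_apex h
  have hp : 0 < (cross Y Z Q * cross Y Z Q') * cross Y Z X ^ 2 := by nlinarith
  rw [h.eq_of_same_side ht hc'.1 (pos_of_mul_pos_left hp (sq_nonneg _))]

/-- A triangle has only one obtuse angle: the side facing it is strictly longer than the others. -/
theorem apex_unique {A B Q A' B' Q' : Plane} (hE : ({A, B, Q} : Finset Plane) = {A', B', Q'})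
    (h : scal A B Q < 0) (h' : scal A' B' Q' < 0) :
    Q = Q' ∧ ((A = A' ∧ B = B') ∨ (A = B' ∧ B = A')) := by
  have hA : A' ∈ ({A, B, Q} : Finset Plane) := by rw [hE]; simp
  have hB : B' ∈ ({A, B, Q} : Finset Plane) := by rw [hE]; simp
  have hQ : Q' ∈ ({A, B, Q} : Finset Plane) := by rw [hE]; simp
  have e1 := scal_eq A B Q
  have e2 := scal_eq A' B' Q'
  simp only [Finset.mem_insert, Finset.mem_singleton] at hA hB hQ
  have hAQ := sq_nonneg (dist A Q)
  have hBQ := sq_nonneg (dist B Q)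
  have hAB := sq_nonneg (dist A B)
  rcases hA with rfl | rfl | rfl <;> rcases hB with rfl | rfl | rfl <;>
    rcases hQ with rfl | rfl | rfl <;>
    first
    | exact ⟨rfl, Or.inl ⟨rfl, rfl⟩⟩
    | exact ⟨rfl, Or.inr ⟨rfl, rfl⟩⟩
    | (exfalso; simp only [dist_self, dist_comm] at *; nlinarith)

/-- The longest side of an obtuse triangle is determined, and so is the triangle on its other side.
-/
theorem IsChildAt.parent_unique (h : IsDeloneTriangulation P 𝒯) {T' : Finset Plane} {X X' : Plane}
    (hc : IsChildAt 𝒯 t T X) (hc' : IsChildAt 𝒯 t T' X') : T = T' := by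
  obtain ⟨ht, hT, Y, Z, Q, rfl, rfl, hs, hcr⟩ := hc
  obtain ⟨-, hT', Y', Z', Q', rfl, hE, hs', hcr'⟩ := hc'
  obtain ⟨rfl, h'⟩ := apex_unique hE hs hs'
  have aux : ∀ V, ({V, Y, Z} : Finset Plane) ∈ 𝒯 → cross Y Z Q * cross Y Z V < 0 → X = V := by
    intro V hV hcV
    have hp : 0 < (cross Y Z X * cross Y Z V) * cross Y Z Q ^ 2 := by nlinarith
    rw [rotate_triple] at hT hV
    exact h.eq_of_same_side hT hV (pos_of_mul_pos_left hp (sq_nonneg _))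
  rcases h' with ⟨rfl, rfl⟩ | ⟨rfl, rfl⟩
  · rw [aux X' hT' hcr']
  · rw [swap_triple] at hT'
    rw [cross_swap, cross_swap Y Z X'] at hcr'
    rw [aux X' hT' (by linarith), swap_triple]

theorem IsChildAt.isObtuse {X : Plane} (hc : IsChildAt 𝒯 t T X) : IsObtuse t := by
  obtain ⟨-, -, Y, Z, Q, -, rfl, hs, -⟩ := hc
  exact isObtuse_iff.2 (Or.inr (Or.inr hs))

theorem exists_apex_of_isObtuse (hT : IsTriangle t) (ho : IsObtuse t) :
    ∃ A B Q, t = {A, B, Q} ∧ scal A B Q < 0 := by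
  obtain ⟨A, B, C, rfl, -⟩ := hT.exists_eq
  rcases isObtuse_iff.1 ho with h | h | h
  · exact ⟨B, C, A, rotate_triple _ _ _, h⟩
  · exact ⟨A, C, B, swap_triple _ _ _, h⟩
  · exact ⟨A, B, C, rfl, h⟩

theorem IsDeloneTriangulation.exists_parent (hP : IsRRSystem r R P)
    (h : IsDeloneTriangulation P 𝒯) (ht : t ∈ 𝒯) (ho : IsObtuse t) :
    ∃ T X, IsChildAt 𝒯 t T X := by
  obtain ⟨A, B, Q, rfl, hs⟩ := exists_apex_of_isObtuse (h.isTriangle t ht) ho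
  obtain ⟨D, hD, hcr⟩ := h.exists_neighbour hP ht
  exact ⟨_, D, ht, hD, A, B, Q, (rotate_triple _ _ _).symm, rfl, hs, hcr⟩

theorem IsChildAt.mem_vertex {X : Plane} (hc : IsChildAt 𝒯 t T X) : X ∈ T := by
  obtain ⟨-, -, Y, Z, Q, rfl, -⟩ := hc
  simp

theorem IsDeloneTriangulation.scal_mul_area_nonneg (h : IsDeloneTriangulation P 𝒯) {X Y Z Q : Plane}
    (ht : {Y, Z, Q} ∈ 𝒯) (hT : {X, Y, Z} ∈ 𝒯) (hcr : cross Y Z Q * cross Y Z X < 0) :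
    0 ≤ scal Y Z X * area {Y, Z, Q} + scal Y Z Q * area {X, Y, Z} := by
  obtain ⟨o, ρ, h1, h2⟩ := h.empty_circle _ hT
  have := delone_inequality (A := Y) (B := Z) (P := X) (Q := Q) (h1 Y (by simp))
    (h1 Z (by simp)) (h1 X (by simp)) (h2 Q (h.vertices _ ht (by simp))) (by linarith)
  rw [area_eq, area_eq, ← cross_rotate X Y Z]
  linarith

/-- The angle of the neighbour that faces the longest side of an obtuse triangle is acute. -/
theorem IsChildAt.scal_pos (h : IsDeloneTriangulation P 𝒯) {X Y Z : Plane}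
    (hc : IsChildAt 𝒯 t {X, Y, Z} X) : 0 < scal Y Z X := by
  obtain ⟨Q, rfl, hs, hcr⟩ := hc.exists_apex h
  have h1 := h.scal_mul_area_nonneg hc.1 hc.2.1 hcr
  have h2 : 0 < area {X, Y, Z} := by
    rw [area_eq]; have := abs_pos.2 (h.cross_ne_zero hc.2.1); positivity
  have h3 : 0 < area {Y, Z, Q} := by
    rw [area_eq]; have := abs_pos.2 (h.cross_ne_zero hc.1); positivity
  by_contra! h4
  nlinarith [mul_nonneg (neg_nonneg.2 h4) h3.le, mul_pos (neg_pos.2 hs) h2]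

theorem IsChildAt.area_bounds (hP : IsRRSystem r R P) (hR : R ^ 2 ≤ 8 * r ^ 2)
    (h : IsDeloneTriangulation P 𝒯) {X Y Z : Plane} (hc : IsChildAt 𝒯 t {X, Y, Z} X) :
    8 ≤ sqDist r Y Z ∧ 1 ≤ relArea r t ∧ 64 - (sqDist r Y Z - 8) ^ 2 ≤ 16 * relArea r t ^ 2 ∧
    64 * relArea r {X, Y, Z} ^ 2 ≤ 16 * relArea r t ^ 2 * relArea r {X, Y, Z} ^ 2 +
      ((sqDist r X Z + sqDist r X Y - sqDist r Y Z) * relArea r t) ^ 2 := by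
  obtain ⟨Q, rfl, hs, hcr⟩ := hc.exists_apex h
  have hr := hP.r_pos
  obtain ⟨h1, h2, h3, h4, h5, h6⟩ := h.metric_bounds hP hR hc.1
  have hS := (h.metric_bounds hP hR hc.2.1).2.2.2.1
  have e1 := scal_div r Y Z Q
  have hs' : scal Y Z Q / r ^ 2 < 0 := div_neg_of_neg_of_pos hs (by positivity)
  have hl : sqDist r Y Q + sqDist r Z Q ≤ sqDist r Y Z := by linarith
  have h5' : 16 * relArea r {Y, Z, Q} ^ 2 = 4 * sqDist r Y Q * sqDist r Z Q -
      (sqDist r Y Z - sqDist r Y Q - sqDist r Z Q) ^ 2 := by linear_combination h5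
  obtain ⟨b1, b2, b3⟩ := area_bounds_of_obtuse h2 h1 hl h4.le h5' (by linarith)
  refine ⟨b1, b2, b3, cot_bound_of_obtuse h2 h1 hl hS.le h5' ?_⟩
  have hd := h.scal_mul_area_nonneg hc.1 hc.2.1 hcr
  have e2 := scal_div r Y Z X
  rw [sqDist_comm r Y X, sqDist_comm r Z X] at e2
  -- `e3` and `e4` express the two cotangent quantities by scalar products, so that the Delone
  -- inequality becomes `hD` of `cot_bound_of_obtuse`.
  have e3 : sqDist r X Z + sqDist r X Y - sqDist r Y Z = 2 * (scal Y Z X / r ^ 2) := by linarith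
  have e4 : sqDist r Y Z - sqDist r Y Q - sqDist r Z Q = - (2 * (scal Y Z Q / r ^ 2)) := by linarith
  rw [e3, e4, relArea, relArea, ← sub_nonneg]
  have : 2 * (scal Y Z X / r ^ 2) * (area {Y, Z, Q} / r ^ 2) -
      -(2 * (scal Y Z Q / r ^ 2)) * (area {X, Y, Z} / r ^ 2) =
      2 * (scal Y Z X * area {Y, Z, Q} + scal Y Z Q * area {X, Y, Z}) / (r ^ 2) ^ 2 := by
    field_simp
    ring
  rw [this]
  positivity

theorem sqDist_le_of_scal_nonneg {X Y Z : Plane} (h : 0 ≤ scal X Y Z) :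
    sqDist r X Y ≤ sqDist r X Z + sqDist r Y Z := by
  have h1 := scal_div r X Y Z
  have : 0 ≤ scal X Y Z / r ^ 2 := by positivity
  linarith

theorem sqDist_le_of_not_isObtuse {X Y Z : Plane} (h : ¬ IsObtuse {X, Y, Z}) :
    sqDist r Y Z ≤ sqDist r X Z + sqDist r X Y ∧ sqDist r X Z ≤ sqDist r Y Z + sqDist r X Y ∧
    sqDist r X Y ≤ sqDist r Y Z + sqDist r X Z := by
  rw [isObtuse_iff] at h
  push Not at h
  have h1 := sqDist_le_of_scal_nonneg (r := r) h.1
  have h2 := sqDist_le_of_scal_nonneg (r := r) h.2.1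
  have h3 := sqDist_le_of_scal_nonneg (r := r) h.2.2
  rw [sqDist_comm r Y X, sqDist_comm r Z X] at h1
  rw [sqDist_comm r Z Y] at h2
  exact ⟨by linarith, by linarith, by linarith⟩

theorem nonobtuse_add_one (hP : IsRRSystem r R P) (hR : R ^ 2 ≤ 8 * r ^ 2)
    (h : IsDeloneTriangulation P 𝒯) {X Y Z : Plane} (ho : ¬ IsObtuse {X, Y, Z})
    (hc : IsChildAt 𝒯 t {X, Y, Z} X) : 4 ≤ relArea r {X, Y, Z} + relArea r t := by
  obtain ⟨a1, a2, a3, a4⟩ := hc.area_bounds hP hR h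
  obtain ⟨h1, h2, h3, h4, h5, h6⟩ := h.metric_bounds hP hR hc.2.1
  obtain ⟨n1, n2, n3⟩ := sqDist_le_of_not_isObtuse (r := r) ho
  exact area_add_ge_of_nonobtuse a1 h2 h3 n1 n2 n3 h4.le h5 a2 a3

/-- The second child only serves to make a second side long. The bound for both children is the mean
of this one and the one with roles exchanged. -/
theorem nonobtuse_add_two (hP : IsRRSystem r R P) (hR : R ^ 2 ≤ 8 * r ^ 2)
    (h : IsDeloneTriangulation P 𝒯) {t' : Finset Plane} {X Y Z : Plane}
    (ho : ¬ IsObtuse {X, Y, Z}) (hc : IsChildAt 𝒯 t {X, Y, Z} X)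
    (hc' : IsChildAt 𝒯 t' {X, Y, Z} Y) : 6 ≤ relArea r {X, Y, Z} + 2 * relArea r t := by
  obtain ⟨a1, a2, a3, a4⟩ := hc.area_bounds hP hR h
  rw [rotate_triple] at hc'
  have b1 := (hc'.area_bounds hP hR h).1
  rw [sqDist_comm] at b1
  obtain ⟨h1, h2, h3, h4, h5, h6⟩ := h.metric_bounds hP hR hc.2.1
  obtain ⟨n1, n2, n3⟩ := sqDist_le_of_not_isObtuse (r := r) ho
  exact area_add_two_mul_ge_of_nonobtuse a1 b1 h3 n1 n2 n3 h4.le h5 a2 a3 a4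

theorem nonobtuse_add_three (hP : IsRRSystem r R P) (hR : R ^ 2 ≤ 8 * r ^ 2)
    (h : IsDeloneTriangulation P 𝒯) {t' t'' : Finset Plane} {X Y Z : Plane}
    (ho : ¬ IsObtuse {X, Y, Z}) (hc : IsChildAt 𝒯 t {X, Y, Z} X)
    (hc' : IsChildAt 𝒯 t' {X, Y, Z} Y) (hc'' : IsChildAt 𝒯 t'' {X, Y, Z} Z) :
    8 ≤ relArea r {X, Y, Z} + 3 * relArea r t := by
  obtain ⟨a1, a2, a3, a4⟩ := hc.area_bounds hP hR h
  rw [rotate_triple] at hc'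
  rw [rotate_triple, rotate_triple] at hc''
  have b1 := (hc'.area_bounds hP hR h).1
  have c1 := (hc''.area_bounds hP hR h).1
  rw [sqDist_comm] at b1
  obtain ⟨h1, h2, h3, h4, h5, h6⟩ := h.metric_bounds hP hR hc.2.1
  obtain ⟨n1, n2, n3⟩ := sqDist_le_of_not_isObtuse (r := r) ho
  exact area_add_three_mul_ge_of_nonobtuse a1 b1 c1 n1 n2 n3 h4.le h5 a2 a3 a4

theorem add_sqDist_le_of_scal_neg {X Y Z : Plane} (h : scal X Y Z < 0) :
    sqDist r Y Z + sqDist r X Z ≤ sqDist r X Y := by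
  have h1 := scal_div r X Y Z
  have : scal X Y Z / r ^ 2 ≤ 0 := div_nonpos_of_nonpos_of_nonneg h.le (by positivity)
  linarith

theorem obtuse_add_one (hP : IsRRSystem r R P) (hR : R ^ 2 ≤ 8 * r ^ 2)
    (h : IsDeloneTriangulation P 𝒯) {X Y Z : Plane} (ho : scal X Y Z < 0)
    (hc : IsChildAt 𝒯 t {X, Y, Z} X) : 4 ≤ relArea r {X, Y, Z} + relArea r t := by
  obtain ⟨a1, a2, a3, a4⟩ := hc.area_bounds hP hR h
  obtain ⟨h1, h2, h3, h4, h5, h6⟩ := h.metric_bounds hP hR hc.2.1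
  exact area_add_ge_of_obtuse a1 h2 (add_sqDist_le_of_scal_neg ho) h4.le
    (by linear_combination h5) h6 a2 a3

theorem obtuse_add_two (hP : IsRRSystem r R P) (hR : R ^ 2 ≤ 8 * r ^ 2)
    (h : IsDeloneTriangulation P 𝒯) {t' : Finset Plane} {X Y Z : Plane} (ho : scal X Y Z < 0)
    (hc : IsChildAt 𝒯 t {X, Y, Z} X) (hc' : IsChildAt 𝒯 t' {X, Y, Z} Y) :
    6 ≤ relArea r {X, Y, Z} + 2 * relArea r t := by
  obtain ⟨a1, a2, a3, a4⟩ := hc.area_bounds hP hR h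
  rw [rotate_triple] at hc'
  have b1 := (hc'.area_bounds hP hR h).1
  rw [sqDist_comm] at b1
  obtain ⟨h1, h2, h3, h4, h5, h6⟩ := h.metric_bounds hP hR hc.2.1
  exact area_add_two_mul_ge_of_obtuse a1 b1 (add_sqDist_le_of_scal_neg ho) h4.le h6 a2 a3

end

/-! ### The grouping -/

section
variable {r R : ℝ} {P : Set Plane} {𝒯 : Set (Finset Plane)} {t T : Finset Plane}

theorem IsChildAt.isLongestSide (h : IsDeloneTriangulation P 𝒯) {X : Plane}
    (hc : IsChildAt 𝒯 t T X) : IsLongestSide (T.erase X) t := by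
  obtain ⟨ht, hT, Y, Z, Q, rfl, rfl, hs, -⟩ := hc
  obtain ⟨hXY, hXZ, hYZ⟩ := ne_of_cross_ne_zero (h.cross_ne_zero hT)
  have he : ({X, Y, Z} : Finset Plane).erase X = {Y, Z} :=
    Finset.erase_insert (by simp [hXY, hXZ])
  have e1 := scal_eq Y Z Q
  have hYQ : dist Y Q ≤ dist Y Z :=
    (abs_le_of_sq_le_sq' (by nlinarith [sq_nonneg (dist Z Q)]) dist_nonneg).2
  have hZQ : dist Z Q ≤ dist Y Z :=
    (abs_le_of_sq_le_sq' (by nlinarith [sq_nonneg (dist Y Q)]) dist_nonneg).2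
  rw [he]
  refine ⟨?_, Finset.card_pair hYZ, ?_⟩
  · intro V hV
    simp only [Finset.mem_insert, Finset.mem_singleton] at hV ⊢
    tauto
  · have key : ∀ x ∈ ({Y, Z, Q} : Finset Plane), ∀ y ∈ ({Y, Z, Q} : Finset Plane),
        dist x y ≤ dist Y Z := by
      intro x hx y hy
      simp only [Finset.mem_insert, Finset.mem_singleton] at hx hy
      rcases hx with rfl | rfl | rfl <;> rcases hy with rfl | rfl | rfl <;>
        first
        | exact le_rfl
        | (rw [dist_self]; exact dist_nonneg)
        | assumption
        | (rw [dist_comm]; assumption)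
        | (rw [dist_comm])
    intro a ha b hb hab
    simp only [Finset.mem_insert, Finset.mem_singleton] at ha hb
    rcases ha with rfl | rfl <;> rcases hb with rfl | rfl
    · exact absurd rfl hab
    · exact key
    · rw [dist_comm a b]; exact key
    · exact absurd rfl hab

theorem not_isLongestSide_of_obtuse {X Y Z V : Plane} (hcr : cross X Y Z ≠ 0)
    (hs : scal X Y Z < 0) (hV : V = X ∨ V = Y) :
    ¬ IsLongestSide (({X, Y, Z} : Finset Plane).erase V) {X, Y, Z} := by
  obtain ⟨hXY, hXZ, hYZ⟩ := ne_of_cross_ne_zero hcr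
  rintro ⟨-, -, h⟩
  have e1 := scal_eq X Y Z
  have hX := dist_pos.2 hXZ
  have hY := dist_pos.2 hYZ
  rcases hV with rfl | rfl
  · have := h Y (by simp [hXY.symm]) Z (by simp [hXZ.symm]) hYZ V (by simp) Y (by simp)
    have := pow_le_pow_left₀ dist_nonneg this 2
    nlinarith
  · have := h X (by simp [hXY]) Z (by simp [hYZ.symm]) hXZ X (by simp) V (by simp)
    have := pow_le_pow_left₀ dist_nonneg this 2
    nlinarith

/-- The vertex facing a child has an acute angle, so it is not the obtuse apex Z. -/
theorem IsChildAt.ne_apex (h : IsDeloneTriangulation P 𝒯) {X Y Z V : Plane}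
    (hs : scal X Y Z < 0) (hc : IsChildAt 𝒯 t {X, Y, Z} V) : V = X ∨ V = Y := by
  have hV := hc.mem_vertex
  simp only [Finset.mem_insert, Finset.mem_singleton] at hV
  rcases hV with hV | hV | rfl
  · exact Or.inl hV
  · exact Or.inr hV
  · rw [rotate_triple, rotate_triple] at hc
    have := hc.scal_pos h
    linarith

/-- A family of obtuse triangles whose longest sides are sides of `T` injects into the vertices
of `T`. -/
theorem exists_vertex_map (h : IsDeloneTriangulation P 𝒯) {K : Finset (Finset Plane)}
    (hK : ∀ t ∈ K, ∃ X, IsChildAt 𝒯 t T X) :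
    ∃ v : Finset Plane → Plane, (∀ t ∈ K, IsChildAt 𝒯 t T (v t)) ∧ Set.InjOn v K := by
  classical
  choose! v hv using hK
  refine ⟨v, hv, fun s hs t ht hst => ?_⟩
  have h1 := hv s hs
  rw [hst] at h1
  exact h1.unique h (hv t ht)

theorem sum_area_nonobtuse (hP : IsRRSystem r R P) (hR : R ^ 2 ≤ 8 * r ^ 2)
    (h : IsDeloneTriangulation P 𝒯) (ho : ¬ IsObtuse T) (hT : T ∈ 𝒯)
    {K : Finset (Finset Plane)} (hK : ∀ t ∈ K, ∃ X, IsChildAt 𝒯 t T X) (hne : K.Nonempty) :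
    K.card ≤ 3 ∧ 2 * ((K.card : ℝ) + 1) ≤ relArea r T + ∑ t ∈ K, relArea r t := by
  obtain ⟨v, hv, hinj⟩ := exists_vertex_map h hK
  have hT3 := (h.isTriangle T hT).1
  have hc3 : K.card ≤ 3 := by
    rw [← hT3]
    exact Finset.card_le_card_of_injOn v (fun t ht => (hv t ht).mem_vertex) hinj
  refine ⟨hc3, ?_⟩
  have hpos := hne.card_pos
  obtain hk | hk | hk : K.card = 1 ∨ K.card = 2 ∨ K.card = 3 := by omega
  · obtain ⟨t, rfl⟩ := Finset.card_eq_one.1 hk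
    have hct := hv t (by simp)
    obtain ⟨Y, Z, Q, rfl, -⟩ := hct.2.2
    have := nonobtuse_add_one hP hR h ho hct
    simp; linarith
  · obtain ⟨t, t', htt', rfl⟩ := Finset.card_eq_two.1 hk
    have hct := hv t (by simp)
    have hct' := hv t' (by simp)
    have hvne : v t ≠ v t' := fun he => htt' (hinj (by simp) (by simp) he)
    obtain ⟨Z, -, -, hE⟩ := eq_triple_of_mem hT3 hct.mem_vertex hct'.mem_vertex hvne
    rw [hE] at hct hct' ho
    have h1 := nonobtuse_add_two hP hR h ho hct hct'
    have hE' : T = {v t', v t, Z} := by rw [hE, Finset.insert_comm]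
    rw [← hE, hE'] at hct hct' ho
    have h2 := nonobtuse_add_two hP hR h ho hct' hct
    rw [← hE'] at h2
    rw [← hE] at h1
    rw [Finset.sum_pair htt', hk]; norm_num; linarith
  · obtain ⟨t, t', t'', h12, h13, h23, rfl⟩ := Finset.card_eq_three.1 hk
    have c1 := hv t (by simp)
    have c2 := hv t' (by simp)
    have c3 := hv t'' (by simp)
    have n12 : v t ≠ v t' := fun he => h12 (hinj (by simp) (by simp) he)
    have n13 : v t ≠ v t'' := fun he => h13 (hinj (by simp) (by simp) he)
    have n23 : v t' ≠ v t'' := fun he => h23 (hinj (by simp) (by simp) he)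
    obtain ⟨Z, -, -, hE⟩ := eq_triple_of_mem hT3 c1.mem_vertex c2.mem_vertex n12
    have hZ : Z = v t'' := by
      have := c3.mem_vertex
      rw [hE] at this
      simp only [Finset.mem_insert, Finset.mem_singleton] at this
      rcases this with e | e | e
      · exact absurd e.symm n13
      · exact absurd e.symm n23
      · exact e.symm
    subst hZ
    have hE2 : T = {v t', v t'', v t} := by rw [hE, rotate_triple]
    have hE3 : T = {v t'', v t, v t'} := by rw [hE2, rotate_triple]
    have b1 : 8 ≤ relArea r T + 3 * relArea r t := by
      rw [hE] at c1 c2 c3 ho ⊢; exact nonobtuse_add_three hP hR h ho c1 c2 c3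
    have b2 : 8 ≤ relArea r T + 3 * relArea r t' := by
      rw [hE2] at c1 c2 c3 ho ⊢; exact nonobtuse_add_three hP hR h ho c2 c3 c1
    have b3 : 8 ≤ relArea r T + 3 * relArea r t'' := by
      rw [hE3] at c1 c2 c3 ho ⊢; exact nonobtuse_add_three hP hR h ho c3 c1 c2
    rw [Finset.sum_insert (by simp [h12, h13]), Finset.sum_pair h23, hk]; norm_num; linarith

theorem sum_area_obtuse (hP : IsRRSystem r R P) (hR : R ^ 2 ≤ 8 * r ^ 2)
    (h : IsDeloneTriangulation P 𝒯) {X Y Z : Plane} (ho : scal X Y Z < 0)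
    {K : Finset (Finset Plane)} (hK : ∀ t ∈ K, ∃ V, IsChildAt 𝒯 t {X, Y, Z} V)
    (hne : K.Nonempty) :
    K.card ≤ 2 ∧ 2 * ((K.card : ℝ) + 1) ≤ relArea r {X, Y, Z} + ∑ t ∈ K, relArea r t := by
  obtain ⟨v, hv, hinj⟩ := exists_vertex_map h hK
  have hvXY : ∀ t ∈ K, v t = X ∨ v t = Y := fun t ht => (hv t ht).ne_apex h ho
  have hc2 : K.card ≤ 2 :=
    (Finset.card_le_card_of_injOn v (t := {X, Y}) (fun t ht => by simpa using hvXY t ht)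
      hinj).trans Finset.card_le_two
  refine ⟨hc2, ?_⟩
  have hE : ({X, Y, Z} : Finset Plane) = {Y, X, Z} := Finset.insert_comm _ _ _
  have ho' : scal Y X Z < 0 := by rw [scal_comm]; exact ho
  have hpos := hne.card_pos
  obtain hk | hk : K.card = 1 ∨ K.card = 2 := by omega
  · obtain ⟨t, rfl⟩ := Finset.card_eq_one.1 hk
    have hct := hv t (by simp)
    have : 4 ≤ relArea r {X, Y, Z} + relArea r t := by
      rcases hvXY t (by simp) with e | e
      · rw [e] at hct; exact obtuse_add_one hP hR h ho hct
      · rw [e, hE] at hct; rw [hE]; exact obtuse_add_one hP hR h ho' hct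
    simp; linarith
  · obtain ⟨t, t', htt', rfl⟩ := Finset.card_eq_two.1 hk
    have hct := hv t (by simp)
    have hct' := hv t' (by simp)
    have hvne : v t ≠ v t' := fun he => htt' (hinj (by simp) (by simp) he)
    have aux : ∀ {s s' : Finset Plane}, IsChildAt 𝒯 s {X, Y, Z} X → IsChildAt 𝒯 s' {X, Y, Z} Y →
        6 ≤ relArea r {X, Y, Z} + relArea r s + relArea r s' := by
      intro s s' hs hs'
      have h1 := obtuse_add_two hP hR h ho hs hs'
      rw [hE] at hs hs'
      have h2 := obtuse_add_two hP hR h ho' hs' hs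
      rw [← hE] at h2
      linarith
    have : 6 ≤ relArea r {X, Y, Z} + relArea r t + relArea r t' := by
      rcases hvXY t (by simp) with e | e <;> rcases hvXY t' (by simp) with e' | e'
      · exact absurd (e.trans e'.symm) hvne
      · rw [e] at hct; rw [e'] at hct'; exact aux hct hct'
      · rw [e] at hct; rw [e'] at hct'; linarith [aux hct' hct]
      · exact absurd (e.trans e'.symm) hvne
    rw [Finset.sum_pair htt', hk]; norm_num; linarith

/-- The length of the longest side, squared, in units of `(2 * r) ^ 2`, rounded down. -/
noncomputable def sideRank (r : ℝ) (t : Finset Plane) : ℕ :=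
  ⌊Metric.diam (t : Set Plane) ^ 2 / (4 * r ^ 2)⌋₊

theorem diam_eq_of_isLongestSide {a b : Plane} (hab : a ≠ b) (h : IsLongestSide {a, b} t) :
    Metric.diam (t : Set Plane) = dist a b := by
  apply le_antisymm
  · exact Metric.diam_le_of_forall_dist_le dist_nonneg
      fun x hx y hy => h.2.2 a (by simp) b (by simp) hab x hx y hy
  · exact Metric.dist_le_diam_of_mem t.finite_toSet.isBounded (h.1 (by simp)) (h.1 (by simp))

/-- The longest side of the child is a short side of T. The squared longest side of T exceeds it by
at least the square of the other short side, hence by 4r², one unit of rank. -/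
theorem IsChildAt.sideRank_lt (hP : IsRRSystem r R P) (h : IsDeloneTriangulation P 𝒯) {X : Plane}
    (hc : IsChildAt 𝒯 t T X) (ho : IsObtuse T) : sideRank r t < sideRank r T := by
  have hr := hP.r_pos
  obtain ⟨A, B, C, rfl, hs⟩ := exists_apex_of_isObtuse (h.isTriangle T hc.2.1) ho
  have hT := hc.2.1
  obtain ⟨hAB, hAC, hBC⟩ := ne_of_cross_ne_zero (h.cross_ne_zero hT)
  have hv := h.vertices _ hT
  have hA : A ∈ P := hv (by simp)
  have hB : B ∈ P := hv (by simp)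
  have hC : C ∈ P := hv (by simp)
  have hAC2 := pow_le_pow_left₀ (by positivity) (hP.two_mul_le_dist hA hC hAC) 2
  have hBC2 := pow_le_pow_left₀ (by positivity) (hP.two_mul_le_dist hB hC hBC) 2
  have hL := hc.isLongestSide h
  have e := scal_eq A B C
  have hd : Metric.diam (t : Set Plane) ^ 2 + 4 * r ^ 2 ≤ dist A B ^ 2 := by
    rcases hc.ne_apex h hs with rfl | rfl
    · have : ({X, B, C} : Finset Plane).erase X = {B, C} :=
        Finset.erase_insert (by simp [hAB, hAC])
      rw [this] at hL
      rw [diam_eq_of_isLongestSide hBC hL]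
      linarith
    · have : ({A, X, C} : Finset Plane).erase X = {A, C} := by
        rw [Finset.insert_comm]; exact Finset.erase_insert (by simp [hAB.symm, hBC])
      rw [this] at hL
      rw [diam_eq_of_isLongestSide hAC hL]
      linarith
  have hd2 : dist A B ^ 2 ≤ Metric.diam ((({A, B, C} : Finset Plane)) : Set Plane) ^ 2 :=
    pow_le_pow_left₀ dist_nonneg (Metric.dist_le_diam_of_mem
      (Finset.finite_toSet _).isBounded (by simp) (by simp)) 2
  rw [sideRank, sideRank, Nat.lt_iff_add_one_le, ← Nat.floor_add_one (by positivity)]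
  apply Nat.floor_le_floor
  rw [← div_self (by positivity : 4 * r ^ 2 ≠ 0), ← add_div]
  gcongr
  linarith

theorem IsDeloneTriangulation.sideRank_le (hP : IsRRSystem r R P)
    (h : IsDeloneTriangulation P 𝒯) (ht : t ∈ 𝒯) :
    sideRank r t ≤ ⌊(2 * R) ^ 2 / (4 * r ^ 2)⌋₊ := by
  apply Nat.floor_le_floor
  have hR : 0 ≤ R := (hP.r_pos.trans hP.r_lt_R).le
  have : Metric.diam (t : Set Plane) ≤ 2 * R :=
    Metric.diam_le_of_forall_dist_le (by positivity) fun x hx y hy =>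
      h.dist_le hP ht (subset_region t hx) (subset_region t hy)
  have := pow_le_pow_left₀ Metric.diam_nonneg this 2
  gcongr

/-- If all triangles were obtuse, passing to parents would raise the rank forever, but sides are at
most 2R. -/
theorem IsDeloneTriangulation.exists_nonobtuse (hP : IsRRSystem r R P)
    (h : IsDeloneTriangulation P 𝒯) : ∃ t ∈ 𝒯, ¬ IsObtuse t := by
  by_contra! hall
  have : ∀ k : ℕ, ∃ t ∈ 𝒯, k ≤ sideRank r t := by
    intro k
    induction k with
    | zero =>
      obtain ⟨t, ht, -⟩ := h.exists_mem 0
      exact ⟨t, ht, Nat.zero_le _⟩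
    | succ k ih =>
      obtain ⟨t, ht, hk⟩ := ih
      obtain ⟨T, X, hc⟩ := h.exists_parent hP ht (hall t ht)
      exact ⟨T, hc.2.1, hk.trans_lt (hc.sideRank_lt hP h (hall T hc.2.1))⟩
  obtain ⟨t, ht, hk⟩ := this (⌊(2 * R) ^ 2 / (4 * r ^ 2)⌋₊ + 1)
  have := h.sideRank_le hP ht
  omega

/-- A well-founded relation has a kernel relative to any predicate. -/
theorem WellFounded.exists_kernel {α : Type*} {rel : α → α → Prop} (hwf : WellFounded rel)
    (Q : α → Prop) : ∃ N : Set α, ∀ t, t ∈ N ↔ Q t ∧ ∀ t', rel t' t → t' ∉ N := by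
  refine ⟨{t | hwf.fix (C := fun _ => Prop) (fun t F => Q t ∧ ∀ t' (h : rel t' t), ¬ F t' h) t},
    fun t => ?_⟩
  rw [Set.mem_ofPred_eq, hwf.fix_eq]
  rfl

theorem IsDeloneTriangulation.exists_grouping (hP : IsRRSystem r R P) (hR : R ^ 2 ≤ 8 * r ^ 2)
    (h : IsDeloneTriangulation P 𝒯) :
    ∃ 𝒢 : Set (Finset (Finset Plane)), IsGrouping 𝒯 𝒢 ∧
      ∀ g ∈ 𝒢, IsGroup1 g ∨ IsGroup2 r g ∨ IsGroup3 r g ∨ IsGroup4 r g := by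
  classical
  have hr := hP.r_pos
  -- Only steps to obtuse parents count, since these raise the rank.
  let rel : Finset Plane → Finset Plane → Prop :=
    fun t T => (∃ X, IsChildAt 𝒯 t T X) ∧ IsObtuse T
  have hwf : WellFounded rel :=
    Subrelation.wf (r := InvImage (· < ·) (sideRank r))
      (fun {a b} hab => by
        obtain ⟨⟨X, hc⟩, ho⟩ := hab
        exact hc.sideRank_lt hP h ho) (InvImage.wf _ wellFounded_lt)
  -- N consists of the small obtuse triangles that join their parents; a small obtuse triangle stays
  -- out exactly when one of its children is in N.
  obtain ⟨N, hN⟩ := hwf.exists_kernel fun t => t ∈ 𝒯 ∧ IsObtuse t ∧ area t < 2 * r ^ 2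
  have hfin : ∀ T, {t | t ∈ N ∧ ∃ X, IsChildAt 𝒯 t T X}.Finite := by
    intro T
    refine Set.Finite.subset (s := ⋃ X ∈ T, {t | IsChildAt 𝒯 t T X}) ?_ ?_
    · refine T.finite_toSet.biUnion fun X _ => Set.Subsingleton.finite ?_
      exact fun s hs t ht => IsChildAt.unique h hs ht
    · rintro t ⟨-, X, hc⟩
      exact Set.mem_iUnion₂.2 ⟨X, hc.mem_vertex, hc⟩
  let K : Finset Plane → Finset (Finset Plane) := fun T => (hfin T).toFinset
  have hK : ∀ t T, t ∈ K T ↔ t ∈ N ∧ ∃ X, IsChildAt 𝒯 t T X := by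
    intro t T; simp [K]
  refine ⟨{g | ∃ T ∈ 𝒯, T ∉ N ∧ g = insert T (K T)}, ⟨?_, ?_⟩, ?_⟩
  · rintro g ⟨T, hT, -, rfl⟩ t ht
    rcases Finset.mem_insert.1 ht with rfl | ht
    · exact hT
    · exact ((hN t).1 ((hK t T).1 ht).1).1.1
  · intro t ht
    by_cases htN : t ∈ N
    · obtain ⟨T, X, hc⟩ := h.exists_parent hP ht ((hN t).1 htN).1.2.1
      -- A triangle with a child in N is not in N, so the parent heads a group.
      have hTN : T ∉ N := fun hTN =>
        ((hN T).1 hTN).2 t ⟨⟨X, hc⟩, ((hN T).1 hTN).1.2.1⟩ htN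
      refine ⟨insert T (K T), ⟨⟨T, hc.2.1, hTN, rfl⟩,
        Finset.mem_insert_of_mem ((hK t T).2 ⟨htN, X, hc⟩)⟩, ?_⟩
      rintro g ⟨⟨T', hT', hTN', rfl⟩, htg⟩
      rcases Finset.mem_insert.1 htg with rfl | htg
      · exact absurd htN hTN'
      · obtain ⟨X', hc'⟩ := ((hK t T').1 htg).2
        rw [hc'.parent_unique h hc]
    · refine ⟨insert t (K t), ⟨⟨t, ht, htN, rfl⟩, Finset.mem_insert_self _ _⟩, ?_⟩
      rintro g ⟨⟨T', hT', hTN', rfl⟩, htg⟩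
      rcases Finset.mem_insert.1 htg with rfl | htg
      · rfl
      · exact absurd ((hK t T').1 htg).1 htN
  · rintro g ⟨T, hT, hTN, rfl⟩
    have hTK : T ∉ K T := fun hh => hTN ((hK T T).1 hh).1
    have hKc : ∀ t ∈ K T, ∃ X, IsChildAt 𝒯 t T X := fun t ht => ((hK t T).1 ht).2
    have havg : (2 * (((K T).card : ℝ) + 1) ≤ relArea r T + ∑ t ∈ K T, relArea r t) →
        GroupAverageAtLeast (insert T (K T)) (2 * r ^ 2) := by
      intro hh
      rw [GroupAverageAtLeast, Finset.sum_insert hTK, Finset.card_insert_of_notMem hTK,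
        le_div_iff₀ (Nat.cast_pos.2 (Nat.succ_pos _))]
      simp only [relArea] at hh
      rw [← Finset.sum_div, ← add_div, le_div_iff₀ (by positivity)] at hh
      push_cast
      linarith
    rcases (K T).eq_empty_or_nonempty with hem | hne
    · rw [hem]
      by_cases ho : IsObtuse T
      · refine Or.inr (Or.inl ⟨T, rfl, ho, ?_⟩)
        -- A small obtuse triangle without children in N would itself belong to N.
        by_contra! harea
        refine hTN ((hN T).2 ⟨⟨hT, ho, harea⟩, fun t' hrel ht' => ?_⟩)
        have : t' ∈ K T := (hK t' T).2 ⟨ht', hrel.1⟩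
        rw [hem] at this
        exact Finset.notMem_empty _ this
      · exact Or.inl ⟨T, rfl, ho⟩
    · have hpos := hne.card_pos
      have hcard := Finset.card_insert_of_notMem hTK
      by_cases ho : IsObtuse T
      · refine Or.inr (Or.inr (Or.inr ⟨T, Finset.mem_insert_self _ _, ho, by omega, ?_⟩))
        obtain ⟨X, Y, Z, hE, hs⟩ := exists_apex_of_isObtuse (h.isTriangle T hT) ho
        have hT' := hT
        rw [hE] at hT'
        obtain ⟨b1, b2⟩ := sum_area_obtuse hP hR h hs (K := K T) (by rw [← hE]; exact hKc) hne
        rw [← hE] at b2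
        refine ⟨by omega, fun t ht htT => ?_, havg b2⟩
        obtain ⟨V, hc⟩ := hKc t (Finset.mem_of_mem_insert_of_ne ht htT)
        refine ⟨hc.isObtuse, T.erase V, hc.isLongestSide h, Finset.erase_subset _ _, ?_⟩
        rw [hE] at hc ⊢
        exact not_isLongestSide_of_obtuse (h.cross_ne_zero hT') hs (hc.ne_apex h hs)
      · refine Or.inr (Or.inr (Or.inl ⟨T, Finset.mem_insert_self _ _, ho, by omega, ?_⟩))
        obtain ⟨b1, b2⟩ := sum_area_nonobtuse hP hR h ho hT hKc hne
        refine ⟨by omega, fun t ht htT => ?_, havg b2⟩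
        obtain ⟨V, hc⟩ := hKc t (Finset.mem_of_mem_insert_of_ne ht htT)
        exact ⟨hc.isObtuse, T.erase V, hc.isLongestSide h, Finset.erase_subset _ _⟩

end

/-! ### Averages over large discs -/

section
variable {r R : ℝ} {P : Set Plane} {𝒯 : Set (Finset Plane)} {t T : Finset Plane}

theorem IsTriangle.region_nonempty (h : IsTriangle t) : (region t).Nonempty := by
  obtain ⟨A, B, C, rfl, -⟩ := h.exists_eq
  exact ⟨A, subset_region _ (by simp)⟩

theorem IsDeloneTriangulation.finite_window (hP : IsRRSystem r R P)
    (h : IsDeloneTriangulation P 𝒯) (x : Plane) (ρ : ℝ) : (window 𝒯 x ρ).Finite := by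
  refine (h.finite_meeting hP x ρ).subset ?_
  rintro t ⟨ht, hsub⟩
  obtain ⟨X, hX⟩ := (h.isTriangle t ht).region_nonempty
  exact ⟨ht, X, hX, hsub hX⟩

theorem windowAverage_eq {x : Plane} {ρ : ℝ} (hf : (window 𝒯 x ρ).Finite) :
    windowAverage 𝒯 x ρ = (∑ t ∈ hf.toFinset, area t) / (hf.toFinset.card : ℝ) := by
  rw [windowAverage, finsum_mem_eq_finite_toFinset_sum _ hf, Set.ncard_eq_toFinset_card _ hf]

theorem IsDeloneTriangulation.mem_window (hP : IsRRSystem r R P)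
    (h : IsDeloneTriangulation P 𝒯) (ht : t ∈ 𝒯) {x y : Plane} {ρ : ℝ} (hy : y ∈ region t)
    (hxy : dist y x + 2 * R ≤ ρ) : t ∈ window 𝒯 x ρ := by
  refine ⟨ht, fun z hz => ?_⟩
  have := h.dist_le hP ht hz hy
  rw [Metric.mem_closedBall]
  linarith [dist_triangle z y x]

theorem hasAverageArea_of_area_eq (hP : IsRRSystem r R P) (h : IsDeloneTriangulation P 𝒯) {a : ℝ}
    (ha : ∀ t ∈ 𝒯, area t = a) : HasAverageArea 𝒯 a := by
  intro ε hε
  refine ⟨2 * R, fun ρ hρ x => ?_⟩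
  have hf := h.finite_window hP x ρ
  obtain ⟨t, ht, hxt⟩ := h.exists_mem x
  have htw : t ∈ hf.toFinset := by
    rw [Set.Finite.mem_toFinset]
    exact h.mem_window hP ht hxt (by rw [dist_self]; linarith)
  have hcard : (0 : ℝ) < hf.toFinset.card := by exact_mod_cast Finset.card_pos.2 ⟨t, htw⟩
  rw [windowAverage_eq hf, Finset.sum_congr rfl
    (fun s hs => ha s ((Set.Finite.mem_toFinset hf).1 hs).1), Finset.sum_const, nsmul_eq_mul,
    mul_div_cancel_left₀ _ hcard.ne', sub_self, abs_zero]
  exact hε.le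

theorem IsDeloneTriangulation.sum_area (h : IsDeloneTriangulation P 𝒯)
    {F : Finset (Finset Plane)} (hF : ∀ t ∈ F, t ∈ 𝒯) :
    ∑ t ∈ F, area t = volume.real (⋃ t ∈ F, region t) := by
  rw [measureReal_biUnion_finset₀ (fun s hs t ht hst => h.aedisjoint (hF s hs) (hF t ht) hst)
    (fun t _ => (isCompact_region t).measurableSet.nullMeasurableSet)
    (fun t _ => (isCompact_region t).measure_ne_top)]
  rfl

theorem volume_real_closedBall (x : Plane) {ρ : ℝ} (hρ : 0 ≤ ρ) :
    volume.real (Metric.closedBall x ρ) = Real.pi * ρ ^ 2 := by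
  rw [measureReal_def, EuclideanSpace.volume_closedBall_fin_two, ENNReal.toReal_mul,
    ENNReal.toReal_pow, ENNReal.toReal_ofReal hρ,
    ENNReal.toReal_ofReal Real.pi_pos.le, mul_comm]

theorem IsDeloneTriangulation.area_le (hP : IsRRSystem r R P)
    (h : IsDeloneTriangulation P 𝒯) (ht : t ∈ 𝒯) : area t ≤ Real.pi * R ^ 2 := by
  obtain ⟨o, ho⟩ := h.exists_region_subset hP ht
  rw [← volume_real_closedBall o (hP.r_pos.trans hP.r_lt_R).le]
  exact measureReal_mono ho measure_closedBall_lt_top.ne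

/-- The product of the squared sides is at least 64 in units of r, so the circumradius bound gives
squared area at least 1/2. The cruder area bound 1/2 is enough for counting. -/
theorem IsDeloneTriangulation.le_area (hP : IsRRSystem r R P) (hR : R ^ 2 ≤ 8 * r ^ 2)
    (h : IsDeloneTriangulation P 𝒯) (ht : t ∈ 𝒯) : r ^ 2 / 2 ≤ area t := by
  have hr := hP.r_pos
  obtain ⟨A, B, C, rfl, -⟩ := (h.isTriangle t ht).exists_eq
  obtain ⟨h1, h2, h3, h4, -, h6⟩ := h.metric_bounds hP hR ht
  have h7 : 16 ≤ sqDist r B C * sqDist r A C := by nlinarith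
  have h8 : 64 ≤ sqDist r B C * sqDist r A C * sqDist r A B := by nlinarith
  have h9 : 1 / 2 ≤ relArea r {A, B, C} := by nlinarith
  rw [relArea, le_div_iff₀ (by positivity)] at h9
  linarith

/-- Every member of a group shares a vertex with its head, so groups have bounded diameter. -/
theorem group_nonempty_inter {g : Finset (Finset Plane)}
    (hg : IsGroup1 g ∨ IsGroup2 r g ∨ IsGroup3 r g ∨ IsGroup4 r g) (hne : ∀ t ∈ g, t.Nonempty) :
    ∃ T ∈ g, ∀ t ∈ g, ((t : Set Plane) ∩ T).Nonempty := by
  have hside : ∀ {e t T : Finset Plane}, IsLongestSide e t → e ⊆ T →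
      ((t : Set Plane) ∩ T).Nonempty := by
    intro e t T he heT
    obtain ⟨a, ha⟩ := Finset.card_pos.1 (by rw [he.2.1]; norm_num)
    exact ⟨a, he.1 ha, heT ha⟩
  have hself : ∀ {t : Finset Plane}, t ∈ g → ((t : Set Plane) ∩ t).Nonempty := by
    intro t ht
    rw [Set.inter_self]
    exact hne t ht
  rcases hg with ⟨T, rfl, -⟩ | ⟨T, rfl, -⟩ | ⟨T, hT, -, -, -, hh, -⟩ | ⟨T, hT, -, -, -, hh, -⟩
  · refine ⟨T, by simp, fun t ht => ?_⟩
    obtain rfl := Finset.mem_singleton.1 ht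
    exact hself ht
  · refine ⟨T, by simp, fun t ht => ?_⟩
    obtain rfl := Finset.mem_singleton.1 ht
    exact hself ht
  · refine ⟨T, hT, fun t ht => ?_⟩
    by_cases htT : t = T
    · rw [htT]; exact hself hT
    · obtain ⟨-, e, he, heT⟩ := hh t ht htT
      exact hside he heT
  · refine ⟨T, hT, fun t ht => ?_⟩
    by_cases htT : t = T
    · rw [htT]; exact hself hT
    · obtain ⟨-, e, he, heT, -⟩ := hh t ht htT
      exact hside he heT

theorem nonObtuseInf_le (ht : t ∈ 𝒯) (ho : ¬ IsObtuse t) : nonObtuseInf 𝒯 ≤ area t :=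
  csInf_le ⟨0, by rintro _ ⟨s, -, rfl⟩; exact ENNReal.toReal_nonneg⟩ ⟨t, ⟨ht, ho⟩, rfl⟩

theorem group_sum_nonneg {g : Finset (Finset Plane)} (hgT : ∀ t ∈ g, t ∈ 𝒯)
    (hg : IsGroup1 g ∨ IsGroup2 r g ∨ IsGroup3 r g ∨ IsGroup4 r g) {m : ℝ}
    (hm1 : m ≤ nonObtuseInf 𝒯) (hm2 : m ≤ 2 * r ^ 2) : 0 ≤ ∑ t ∈ g, (area t - m) := by
  have havg : 0 < g.card → GroupAverageAtLeast g (2 * r ^ 2) → 0 ≤ ∑ t ∈ g, (area t - m) := by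
    intro hc hh
    have hc' : (0 : ℝ) < g.card := by exact_mod_cast hc
    rw [GroupAverageAtLeast, le_div_iff₀ hc'] at hh
    rw [Finset.sum_sub_distrib, Finset.sum_const, nsmul_eq_mul]
    nlinarith
  rcases hg with ⟨T, rfl, ho⟩ | ⟨T, rfl, -, ha⟩ | ⟨T, hT, -, -, -, -, hh⟩ | ⟨T, hT, -, -, -, -, hh⟩
  · have := nonObtuseInf_le (hgT T (by simp)) ho
    simp; linarith
  · simp; linarith
  · exact havg (Finset.card_pos.2 ⟨T, hT⟩) hh
  · exact havg (Finset.card_pos.2 ⟨T, hT⟩) hh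

theorem IsDeloneTriangulation.averageAreaAtLeast (hP : IsRRSystem r R P) (hR : R ^ 2 ≤ 8 * r ^ 2)
    (h : IsDeloneTriangulation P 𝒯) {𝒢 : Set (Finset (Finset Plane))} (hG : IsGrouping 𝒯 𝒢)
    (htype : ∀ g ∈ 𝒢, IsGroup1 g ∨ IsGroup2 r g ∨ IsGroup3 r g ∨ IsGroup4 r g) :
    AverageAreaAtLeast 𝒯 (min (nonObtuseInf 𝒯) (2 * r ^ 2)) := by
  classical
  have hr := hP.r_pos
  have hR0 : 0 < R := hr.trans hP.r_lt_R
  set m := min (nonObtuseInf 𝒯) (2 * r ^ 2) with hm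
  have hm1 : m ≤ nonObtuseInf 𝒯 := min_le_left _ _
  have hm2 : m ≤ 2 * r ^ 2 := min_le_right _ _
  choose! γ hγ using hG.2
  have hγG : ∀ t ∈ 𝒯, γ t ∈ 𝒢 := fun t ht => (hγ t ht).1.1
  have hγmem : ∀ t ∈ 𝒯, t ∈ γ t := fun t ht => (hγ t ht).1.2
  have hγuniq : ∀ t ∈ 𝒯, ∀ g ∈ 𝒢, t ∈ g → g = γ t := fun t ht g hg htg => (hγ t ht).2 g ⟨hg, htg⟩
  -- A path through t, the head of the group and s crosses three triangles of diameter at most 2R.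
  have hdist : ∀ t ∈ 𝒯, ∀ s ∈ γ t, ∀ X ∈ region t, ∀ Y ∈ region s, dist Y X ≤ 6 * R := by
    intro t ht s hs X hX Y hY
    have hsub := hG.1 _ (hγG t ht)
    obtain ⟨T, hT, hTi⟩ := group_nonempty_inter (htype _ (hγG t ht)) (fun t ht => by
      rw [← Finset.card_pos, (h.isTriangle t (hsub t ht)).1]; norm_num)
    obtain ⟨a, hat, haT⟩ := hTi t (hγmem t ht)
    obtain ⟨b, hbs, hbT⟩ := hTi s hs
    have h1 := h.dist_le hP ht (subset_region t hat) hX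
    have h2 := h.dist_le hP (hsub T hT) (subset_region T hbT) (subset_region T haT)
    have h3 := h.dist_le hP (hsub s hs) hY (subset_region s hbs)
    linarith [dist_triangle Y b X, dist_triangle b a X]
  intro ε hε
  -- The first bound accommodates the annulus of width 6R; the second makes the boundary loss 48πRρ
  -- at most ε times the number of triangles.
  refine ⟨max (6 * R) (192 * Real.pi * R ^ 3 / ε), fun ρ hρ x => ?_⟩
  have hρ1 : 6 * R ≤ ρ := (le_max_left _ _).trans hρ
  have hρ2 : 192 * Real.pi * R ^ 3 / ε ≤ ρ := (le_max_right _ _).trans hρ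
  have hf := h.finite_window hP x ρ
  rw [windowAverage_eq hf]
  set W := hf.toFinset with hW
  have hWmem : ∀ t, t ∈ W ↔ t ∈ window 𝒯 x ρ := fun t => Set.Finite.mem_toFinset hf
  have hWT : ∀ t ∈ W, t ∈ 𝒯 := fun t ht => ((hWmem t).1 ht).1
  -- the number of triangles is at least quadratic in the radius
  have hN : (ρ - 2 * R) ^ 2 ≤ R ^ 2 * W.card := by
    have h1 : volume.real (Metric.closedBall x (ρ - 2 * R)) ≤ ∑ t ∈ W, area t := by
      rw [h.sum_area hWT]
      refine measureReal_mono (fun y hy => ?_)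
        (((W.isCompact_biUnion fun t _ => isCompact_region t)).measure_ne_top)
      obtain ⟨t, ht, hyt⟩ := h.exists_mem y
      refine Set.mem_iUnion₂.2 ⟨t, (hWmem t).2 (h.mem_window hP ht hyt ?_), hyt⟩
      have := Metric.mem_closedBall.1 hy
      linarith
    have h2 : ∑ t ∈ W, area t ≤ W.card * (Real.pi * R ^ 2) := by
      rw [← nsmul_eq_mul]
      exact Finset.sum_le_card_nsmul _ _ _ fun t ht => h.area_le hP (hWT t ht)
    rw [volume_real_closedBall x (by linarith)] at h1
    have h3 := Real.pi_pos
    have h4 : Real.pi * (ρ - 2 * R) ^ 2 ≤ Real.pi * (R ^ 2 * W.card) := by linarith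
    exact le_of_mul_le_mul_left h4 h3
  -- the triangles near the boundary of the disc
  set B := W.filter fun t => ¬ γ t ⊆ W with hB
  have hBc : r ^ 2 / 2 * B.card ≤ 12 * Real.pi * R * ρ := by
    have hBT : ∀ t ∈ B, t ∈ 𝒯 := fun t ht => hWT t (Finset.mem_filter.1 ht).1
    have h1 : B.card * (r ^ 2 / 2) ≤ ∑ t ∈ B, area t := by
      rw [← nsmul_eq_mul]
      exact Finset.card_nsmul_le_sum _ _ _ fun t ht => h.le_area hP hR (hBT t ht)
    rw [h.sum_area hBT] at h1
    have h2 : volume.real (⋃ t ∈ B, region t) ≤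
        volume.real (Metric.closedBall x ρ \ Metric.closedBall x (ρ - 6 * R)) := by
      refine measureReal_mono (fun y hy => ?_)
        (measure_ne_top_of_subset Set.sdiff_subset measure_closedBall_lt_top.ne)
      obtain ⟨t, ht, hyt⟩ := Set.mem_iUnion₂.1 hy
      obtain ⟨htW, htγ⟩ := Finset.mem_filter.1 ht
      refine ⟨((hWmem t).1 htW).2 hyt, fun hyx => htγ fun s hs => (hWmem s).2 ⟨?_, fun z hz => ?_⟩⟩
      · exact hG.1 _ (hγG t (hWT t htW)) s hs
      · have h3 := hdist t (hWT t htW) s hs y hyt z hz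
        rw [Metric.mem_closedBall] at hyx ⊢
        linarith [dist_triangle z y x]
    rw [measureReal_sdiff (Metric.closedBall_subset_closedBall (by linarith))
      measurableSet_closedBall measure_closedBall_lt_top.ne, volume_real_closedBall x (by linarith),
      volume_real_closedBall x (by linarith)] at h2
    have h3 := Real.pi_pos
    nlinarith [mul_pos h3 (pow_pos hR0 2)]
  -- complete groups
  have hcomplete : 0 ≤ ∑ t ∈ W.filter (fun t => γ t ⊆ W), (area t - m) := by
    rw [← Finset.sum_fiberwise_of_maps_to (t := (W.filter (fun t => γ t ⊆ W)).image γ)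
      (g := γ) (fun t ht => Finset.mem_image_of_mem γ ht)]
    refine Finset.sum_nonneg fun g hg => ?_
    obtain ⟨t, ht, rfl⟩ := Finset.mem_image.1 hg
    obtain ⟨htW, htγ⟩ := Finset.mem_filter.1 ht
    have hgG := hγG t (hWT t htW)
    have hfib : (W.filter (fun t => γ t ⊆ W)).filter (fun s => γ s = γ t) = γ t := by
      ext s
      simp only [Finset.mem_filter]
      constructor
      · rintro ⟨⟨hsW, -⟩, hs⟩
        rw [← hs]; exact hγmem s (hWT s hsW)
      · intro hs
        have hsW := htγ hs
        have := hγuniq s (hWT s hsW) _ hgG hs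
        exact ⟨⟨hsW, this ▸ htγ⟩, this.symm⟩
    rw [hfib]
    exact group_sum_nonneg (hG.1 _ hgG) (htype _ hgG) hm1 hm2
  -- A triangle of an incomplete group loses at most m ≤ 2r².
  have hBsum : - (2 * r ^ 2 * B.card) ≤ ∑ t ∈ B, (area t - m) := by
    have := Finset.card_nsmul_le_sum B (fun t => area t - m) (- (2 * r ^ 2)) (fun t _ => by
      have : 0 ≤ area t := ENNReal.toReal_nonneg
      linarith)
    rw [nsmul_eq_mul] at this
    linarith
  have hsplit := Finset.sum_filter_add_sum_filter_not W (fun t => γ t ⊆ W) (fun t => area t - m)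
  have htot : ∑ t ∈ W, (area t - m) = ∑ t ∈ W, area t - W.card * m := by
    rw [Finset.sum_sub_distrib, Finset.sum_const, nsmul_eq_mul]
  have hNpos : (0 : ℝ) < W.card := by
    by_contra! hcon
    nlinarith [pow_pos hR0 2, sq_nonneg (ρ - 6 * R)]
  rw [le_div_iff₀ hNpos]
  -- Since ρ ≥ 6R, ρ - 2R is at least ρ/2.
  have hq : ρ ^ 2 ≤ 4 * R ^ 2 * W.card := by nlinarith
  have herr : 48 * Real.pi * R * ρ ≤ ε * W.card := by
    rw [div_le_iff₀ hε] at hρ2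
    have hρ0 : 0 < ρ := by linarith
    have h1 : 192 * Real.pi * R ^ 3 * ρ ≤ ε * (4 * R ^ 2 * W.card) := by nlinarith
    have h2 : 4 * R ^ 2 * (48 * Real.pi * R * ρ) ≤ 4 * R ^ 2 * (ε * W.card) := by linarith
    exact le_of_mul_le_mul_left h2 (by positivity)
  linarith

end

/-! ### The lattice triangulation generated by a non-obtuse triangle -/

/-- The lattice that is generated by the triangle `A B C`. -/
noncomputable def latticePoint (A B C : Plane) (m n : ℤ) : Plane :=
  A + (m : ℝ) • (B - A) + (n : ℝ) • (C - A)

/-- The translates (`σ = 1`) and reflected translates (`σ = -1`) of the triangle `A B C`. -/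
noncomputable def latticeTriangle (A B C : Plane) (σ i j : ℤ) : Finset Plane :=
  {latticePoint A B C i j, latticePoint A B C (i + σ) j, latticePoint A B C i (j + σ)}

/-- The triangulation of the plane by the translates of `A B C` and of its reflection. -/
def latticeTriangulation (A B C : Plane) : Set (Finset Plane) :=
  {t | ∃ σ i j : ℤ, (σ = 1 ∨ σ = -1) ∧ t = latticeTriangle A B C σ i j}

section
variable {A B C : Plane}

theorem latticePoint_zero (m n : ℤ) :
    latticePoint A B C m n 0 = A 0 + m * (B 0 - A 0) + n * (C 0 - A 0) := by
  simp [latticePoint]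

theorem latticePoint_one (m n : ℤ) :
    latticePoint A B C m n 1 = A 1 + m * (B 1 - A 1) + n * (C 1 - A 1) := by
  simp [latticePoint]

theorem cross_latticeTriangle {σ : ℤ} (hσ : σ = 1 ∨ σ = -1) (i j : ℤ) :
    cross (latticePoint A B C i j) (latticePoint A B C (i + σ) j) (latticePoint A B C i (j + σ)) =
      cross A B C := by
  rw [cross, cross]
  simp only [latticePoint_zero, latticePoint_one]
  rcases hσ with rfl | rfl <;> push_cast <;> ring

theorem area_latticeTriangle {σ : ℤ} (hσ : σ = 1 ∨ σ = -1) (i j : ℤ) :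
    area (latticeTriangle A B C σ i j) = area {A, B, C} := by
  rw [latticeTriangle, area_eq, cross_latticeTriangle hσ, area_eq]

theorem not_isObtuse_latticeTriangle {σ : ℤ} (hσ : σ = 1 ∨ σ = -1) (i j : ℤ)
    (h : ¬ IsObtuse {A, B, C}) : ¬ IsObtuse (latticeTriangle A B C σ i j) := by
  rw [latticeTriangle, isObtuse_iff]
  rw [isObtuse_iff] at h
  convert h using 2
  · congr! 1
    simp only [scal, latticePoint_zero, latticePoint_one]
    rcases hσ with rfl | rfl <;> push_cast <;> ring
  · congr! 2 <;>
    · simp only [scal, latticePoint_zero, latticePoint_one]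
      rcases hσ with rfl | rfl <;> push_cast <;> ring

theorem exists_coords (hcr : cross A B C ≠ 0) (X : Plane) :
    ∃ x y : ℝ, X 0 = A 0 + x * (B 0 - A 0) + y * (C 0 - A 0) ∧
      X 1 = A 1 + x * (B 1 - A 1) + y * (C 1 - A 1) := by
  refine ⟨cross A X C / cross A B C, cross A B X / cross A B C, ?_, ?_⟩ <;>
  · field_simp
    simp only [cross]
    ring

theorem coords_unique (hcr : cross A B C ≠ 0) {x y x' y' : ℝ}
    (h0 : A 0 + x * (B 0 - A 0) + y * (C 0 - A 0) = A 0 + x' * (B 0 - A 0) + y' * (C 0 - A 0))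
    (h1 : A 1 + x * (B 1 - A 1) + y * (C 1 - A 1) = A 1 + x' * (B 1 - A 1) + y' * (C 1 - A 1)) :
    x = x' ∧ y = y' := by
  constructor
  · have : (x - x') * cross A B C = 0 := by
      rw [cross]; linear_combination (C 1 - A 1) * h0 - (C 0 - A 0) * h1
    have := (mul_eq_zero.1 this).resolve_right hcr
    linarith
  · have : (y - y') * cross A B C = 0 := by
      rw [cross]; linear_combination (B 0 - A 0) * h1 - (B 1 - A 1) * h0
    have := (mul_eq_zero.1 this).resolve_right hcr
    linarith

theorem mem_region_latticeTriangle (hcr : cross A B C ≠ 0) {X : Plane} {x y : ℝ}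
    (h0 : X 0 = A 0 + x * (B 0 - A 0) + y * (C 0 - A 0))
    (h1 : X 1 = A 1 + x * (B 1 - A 1) + y * (C 1 - A 1)) (σ i j : ℤ) :
    X ∈ region (latticeTriangle A B C σ i j) ↔ ∃ a b c : ℝ, 0 ≤ a ∧ 0 ≤ b ∧ 0 ≤ c ∧
      a + b + c = 1 ∧ x = i + σ * b ∧ y = j + σ * c := by
  rw [latticeTriangle, mem_region_iff]
  simp only [latticePoint_zero, latticePoint_one]
  push_cast
  constructor
  · rintro ⟨a, b, c, ha, hb, hc, habc, e0, e1⟩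
    refine ⟨a, b, c, ha, hb, hc, habc, ?_⟩
    have ha' : a = 1 - b - c := by linarith
    subst ha'
    apply coords_unique hcr
    · rw [← h0, e0]; ring
    · rw [← h1, e1]; ring
  · rintro ⟨a, b, c, ha, hb, hc, habc, rfl, rfl⟩
    have ha' : a = 1 - b - c := by linarith
    subst ha'
    refine ⟨1 - b - c, b, c, ha, hb, hc, habc, ?_, ?_⟩
    · rw [h0]; ring
    · rw [h1]; ring

/-- In lattice coordinates, the diagonal where the fractional parts sum to 1 cuts each unit cell
into a translate and a reflected translate. -/
theorem latticeTriangulation_cover (hcr : cross A B C ≠ 0) (X : Plane) :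
    ∃ t ∈ latticeTriangulation A B C, X ∈ region t := by
  obtain ⟨x, y, h0, h1⟩ := exists_coords hcr X
  have hx := Int.floor_add_fract x
  have hy := Int.floor_add_fract y
  have hx0 := Int.fract_nonneg x
  have hy0 := Int.fract_nonneg y
  have hx1 := Int.fract_lt_one x
  have hy1 := Int.fract_lt_one y
  rcases le_or_gt (Int.fract x + Int.fract y) 1 with h | h
  · refine ⟨_, ⟨1, ⌊x⌋, ⌊y⌋, Or.inl rfl, rfl⟩, (mem_region_latticeTriangle hcr h0 h1 _ _ _).2
      ⟨1 - Int.fract x - Int.fract y, Int.fract x, Int.fract y, by linarith, hx0, hy0, by ring,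
        by push_cast; linarith, by push_cast; linarith⟩⟩
  · refine ⟨_, ⟨-1, ⌊x⌋ + 1, ⌊y⌋ + 1, Or.inr rfl, rfl⟩,
      (mem_region_latticeTriangle hcr h0 h1 _ _ _).2
      ⟨Int.fract x + Int.fract y - 1, 1 - Int.fract x, 1 - Int.fract y, by linarith, by linarith,
        by linarith, by ring, by push_cast; linarith, by push_cast; linarith⟩⟩

/-- A lattice point whose star contains the point `(x, y)` of a lattice triangle in its interior
is a vertex of the triangle. -/
theorem latticePoint_mem_of_close {τ k l p q : ℤ} (hτ : τ = 1 ∨ τ = -1) {x y a b c : ℝ}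
    (ha : 0 ≤ a) (hb : 0 ≤ b) (hc : 0 ≤ c) (habc : a + b + c = 1) (hx : x = k + τ * b)
    (hy : y = l + τ * c) (hp1 : x - 1 < p) (hp2 : p < x + 1) (hq1 : y - 1 < q) (hq2 : q < y + 1)
    (hs1 : x + y - 1 < p + q) (hs2 : p + q < x + y + 1) :
    latticePoint A B C p q ∈ latticeTriangle A B C τ k l := by
  have key : (p = k ∧ q = l) ∨ (p = k + τ ∧ q = l) ∨ (p = k ∧ q = l + τ) := by
    rcases hτ with rfl | rfl
    · push_cast at hx hy
      have h1 : k - 1 < p := by exact_mod_cast (by linarith : (k : ℝ) - 1 < p)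
      have h2 : p < k + 2 := by exact_mod_cast (by linarith : (p : ℝ) < k + 2)
      have h3 : l - 1 < q := by exact_mod_cast (by linarith : (l : ℝ) - 1 < q)
      have h4 : q < l + 2 := by exact_mod_cast (by linarith : (q : ℝ) < l + 2)
      have h6 : p + q < k + l + 2 := by exact_mod_cast (by linarith : (p + q : ℝ) < k + l + 2)
      omega
    · push_cast at hx hy
      have h1 : k - 2 < p := by exact_mod_cast (by linarith : (k : ℝ) - 2 < p)
      have h2 : p < k + 1 := by exact_mod_cast (by linarith : (p : ℝ) < k + 1)
      have h3 : l - 2 < q := by exact_mod_cast (by linarith : (l : ℝ) - 2 < q)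
      have h4 : q < l + 1 := by exact_mod_cast (by linarith : (q : ℝ) < l + 1)
      have h6 : k + l - 2 < p + q := by exact_mod_cast (by linarith : (k + l - 2 : ℝ) < p + q)
      omega
  rw [latticeTriangle]
  rcases key with ⟨rfl, rfl⟩ | ⟨rfl, rfl⟩ | ⟨rfl, rfl⟩ <;> simp

end

theorem Convex.combination_mem {K : Set Plane} (hK : Convex ℝ K) {U V W : Plane} {a b c : ℝ}
    (ha : 0 ≤ a) (hb : 0 ≤ b) (hc : 0 ≤ c) (habc : a + b + c = 1) (hU : 0 < a → U ∈ K)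
    (hV : 0 < b → V ∈ K) (hW : 0 < c → W ∈ K) : a • U + b • V + c • W ∈ K := by
  have two : ∀ {V W : Plane} {b c : ℝ}, 0 ≤ b → 0 ≤ c → b + c = 1 → (0 < b → V ∈ K) →
      (0 < c → W ∈ K) → b • V + c • W ∈ K := by
    intro V W b c hb hc hbc hV hW
    rcases hb.eq_or_lt with rfl | hb
    · rw [zero_add] at hbc
      subst hbc
      simpa using hW one_pos
    · rcases hc.eq_or_lt with rfl | hc
      · rw [add_zero] at hbc
        subst hbc
        simpa using hV one_pos
      · exact hK (hV hb) (hW hc) hb.le hc.le hbc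
  rcases (add_nonneg hb hc).eq_or_lt with h | h
  · have hb0 : b = 0 := by linarith
    have hc0 : c = 0 := by linarith
    subst hb0 hc0
    have ha1 : a = 1 := by linarith
    subst ha1
    simpa using hU one_pos
  · have hvw : (b / (b + c)) • V + (c / (b + c)) • W ∈ K :=
      two (by positivity) (by positivity) (by field_simp)
        (fun hh => hV ((div_pos_iff_of_pos_right h).1 hh))
        (fun hh => hW ((div_pos_iff_of_pos_right h).1 hh))
    have := two (V := U) ha h.le (by linarith) hU (fun _ => hvw)
    rw [smul_add, smul_smul, smul_smul, mul_div_cancel₀ _ h.ne', mul_div_cancel₀ _ h.ne',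
      ← add_assoc] at this
    exact this

section
variable {A B C : Plane}

/-- Every vertex of s with positive weight at X has X in the interior of its star, so it is also a
vertex of t. Thus X is a combination of common vertices. -/
theorem latticeTriangulation_face_to_face (hcr : cross A B C ≠ 0) {s t : Finset Plane}
    (hs : s ∈ latticeTriangulation A B C) (ht : t ∈ latticeTriangulation A B C) :
    region s ∩ region t = convexHull ℝ ((s : Set Plane) ∩ (t : Set Plane)) := by
  apply Set.Subset.antisymm
  · rintro X ⟨hXs, hXt⟩
    obtain ⟨σ, i, j, hσ, rfl⟩ := hs
    obtain ⟨τ, k, l, hτ, rfl⟩ := ht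
    obtain ⟨x, y, h0, h1⟩ := exists_coords hcr X
    obtain ⟨a, b, c, ha, hb, hc, habc, hx, hy⟩ := (mem_region_latticeTriangle hcr h0 h1 _ _ _).1 hXs
    obtain ⟨a', b', c', ha', hb', hc', habc', hx', hy'⟩ :=
      (mem_region_latticeTriangle hcr h0 h1 _ _ _).1 hXt
    have close := fun p q => latticePoint_mem_of_close (A := A) (B := B) (C := C) (p := p) (q := q)
      hτ ha' hb' hc' habc' hx' hy'
    have hX : X = a • latticePoint A B C i j + b • latticePoint A B C (i + σ) j +
        c • latticePoint A B C i (j + σ) := by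
      have ha1 : a = 1 - b - c := by linarith
      subst ha1
      apply plane_ext
      · rw [h0, hx, hy]
        simp only [PiLp.add_apply, PiLp.smul_apply, smul_eq_mul, latticePoint_zero]
        push_cast; ring
      · rw [h1, hx, hy]
        simp only [PiLp.add_apply, PiLp.smul_apply, smul_eq_mul, latticePoint_one]
        push_cast; ring
    rw [hX]
    refine (convex_convexHull ℝ _).combination_mem ha hb hc habc (fun hpos => ?_) (fun hpos => ?_)
      (fun hpos => ?_)
    · refine subset_convexHull ℝ _ ⟨by simp [latticeTriangle], ?_⟩
      apply close <;> rcases hσ with rfl | rfl <;> push_cast at * <;> linarith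
    · refine subset_convexHull ℝ _ ⟨by simp [latticeTriangle], ?_⟩
      apply close <;> rcases hσ with rfl | rfl <;> push_cast at * <;> linarith
    · refine subset_convexHull ℝ _ ⟨by simp [latticeTriangle], ?_⟩
      apply close <;> rcases hσ with rfl | rfl <;> push_cast at * <;> linarith
  · exact Set.subset_inter (convexHull_mono Set.inter_subset_left)
      (convexHull_mono Set.inter_subset_right)

theorem int_mul_self_sub_nonneg (k : ℤ) : (0 : ℝ) ≤ (k : ℝ) ^ 2 - k := by
  have : 0 ≤ k ^ 2 - k := by
    rcases le_or_gt k 0 with h | h <;> nlinarith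
  exact_mod_cast this

/-- The decomposition of the squared length of a lattice vector. -/
theorem dist_sq_latticePoint (m n i j : ℤ) :
    dist (latticePoint A B C m n) (latticePoint A B C i j) ^ 2 =
      scal A C B * (m - i) ^ 2 + scal A B C * (n - j) ^ 2 +
        scal B C A * ((m - i) + (n - j)) ^ 2 := by
  rw [dist_sq_eq]
  simp only [latticePoint_zero, latticePoint_one, scal]
  ring

theorem one_le_sq_of_ne_zero {k : ℤ} (hk : k ≠ 0) : (1 : ℝ) ≤ (k : ℝ) ^ 2 := by
  have : 0 < k ^ 2 := by positivity
  exact_mod_cast this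

/-- The squared distance is a combination of three nonnegative scalar products with squares of m -
i, n - j and their sum. At least two of these integers are nonzero, and any two of the scalar
products add up to a squared side. -/
theorem le_dist_latticePoint {δ : ℝ} (hδ : 0 ≤ δ) (ho : ¬ IsObtuse {A, B, C})
    (hAB : δ ≤ dist A B) (hAC : δ ≤ dist A C) (hBC : δ ≤ dist B C) {m n i j : ℤ}
    (hne : ¬ (m = i ∧ n = j)) :
    δ ≤ dist (latticePoint A B C m n) (latticePoint A B C i j) := by
  rw [isObtuse_iff] at ho
  push Not at ho
  obtain ⟨hA, hB, hC⟩ := ho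
  have hAB := pow_le_pow_left₀ hδ hAB 2
  have hAC := pow_le_pow_left₀ hδ hAC 2
  have hBC := pow_le_pow_left₀ hδ hBC 2
  have e1 := scal_eq A C B
  have e2 := scal_eq A B C
  have e3 := scal_eq B C A
  rw [dist_comm C B] at e1
  rw [dist_comm B A, dist_comm C A] at e3
  refine (abs_le_of_sq_le_sq' ?_ dist_nonneg).2
  rw [dist_sq_latticePoint]
  have c1 : ((m : ℝ) - i) = ((m - i : ℤ) : ℝ) := by push_cast; ring
  have c2 : ((n : ℝ) - j) = ((n - j : ℤ) : ℝ) := by push_cast; ring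
  have c3 : ((m : ℝ) - i) + (n - j) = (((m - i) + (n - j) : ℤ) : ℝ) := by push_cast; ring
  have hM : scal A C B * ((m : ℝ) - i) ^ 2 ≥ 0 := by positivity
  have hN : scal A B C * ((n : ℝ) - j) ^ 2 ≥ 0 := by positivity
  have hMN : scal B C A * (((m : ℝ) - i) + (n - j)) ^ 2 ≥ 0 := by positivity
  have bM : m - i ≠ 0 → scal A C B ≤ scal A C B * ((m : ℝ) - i) ^ 2 := fun hh => by
    rw [c1]; exact le_mul_of_one_le_right hB (one_le_sq_of_ne_zero hh)
  have bN : n - j ≠ 0 → scal A B C ≤ scal A B C * ((n : ℝ) - j) ^ 2 := fun hh => by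
    rw [c2]; exact le_mul_of_one_le_right hC (one_le_sq_of_ne_zero hh)
  have bMN : (m - i) + (n - j) ≠ 0 → scal B C A ≤ scal B C A * (((m : ℝ) - i) + (n - j)) ^ 2 :=
    fun hh => by rw [c3]; exact le_mul_of_one_le_right hA (one_le_sq_of_ne_zero hh)
  by_cases h1 : m - i = 0
  · have h2 : n - j ≠ 0 := by omega
    have h3 : (m - i) + (n - j) ≠ 0 := by omega
    linarith [bN h2, bMN h3]
  · by_cases h2 : n - j = 0
    · have h3 : (m - i) + (n - j) ≠ 0 := by omega
      linarith [bM h1, bMN h3]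
    · linarith [bM h1, bN h2]

theorem hasEmptyCircumcircle_latticeTriangle (ho : ¬ IsObtuse {A, B, C}) {o : Plane} {ρ : ℝ}
    (hA : dist A o = ρ) (hB : dist B o = ρ) (hC : dist C o = ρ) {σ : ℤ} (hσ : σ = 1 ∨ σ = -1)
    (i j : ℤ) : ∃ c : Plane, (∀ p ∈ latticeTriangle A B C σ i j, dist p c = ρ) ∧
      ∀ m n : ℤ, ρ ≤ dist (latticePoint A B C m n) c := by
  rw [isObtuse_iff] at ho
  push Not at ho
  obtain ⟨sA, sB, sC⟩ := ho
  have hρ : 0 ≤ ρ := hA ▸ dist_nonneg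
  have hA := congrArg (· ^ 2) hA
  have hB := congrArg (· ^ 2) hB
  have hC := congrArg (· ^ 2) hC
  simp only [dist_sq_eq] at hA hB hC
  -- The power of a lattice point with respect to the translated or reflected circumcircle is a
  -- nonnegative combination of terms k² - k, which are nonnegative for integers k.
  have power : ∀ m n : ℤ, dist (latticePoint A B C m n)
      (latticePoint A B C i j + (σ : ℝ) • (o - A)) ^ 2 = ρ ^ 2 +
      (scal A C B * (((σ * (m - i) : ℤ) : ℝ) ^ 2 - (σ * (m - i) : ℤ)) +
      scal A B C * (((σ * (n - j) : ℤ) : ℝ) ^ 2 - (σ * (n - j) : ℤ)) +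
      scal B C A * (((σ * (m - i) + σ * (n - j) : ℤ) : ℝ) ^ 2 -
        (σ * (m - i) + σ * (n - j) : ℤ))) := by
    intro m n
    rw [dist_sq_eq]
    simp only [PiLp.add_apply, PiLp.smul_apply, PiLp.sub_apply, smul_eq_mul, latticePoint_zero,
      latticePoint_one, scal]
    rcases hσ with rfl | rfl
    · push_cast
      linear_combination (1 - ((m : ℝ) - i) - (n - j)) * hA + ((m : ℝ) - i) * hB + ((n : ℝ) - j) * hC
    · push_cast
      linear_combination (1 + ((m : ℝ) - i) + (n - j)) * hA - ((m : ℝ) - i) * hB - ((n : ℝ) - j) * hC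
  refine ⟨latticePoint A B C i j + (σ : ℝ) • (o - A), ?_, ?_⟩
  · intro p hp
    have hsq : dist p (latticePoint A B C i j + (σ : ℝ) • (o - A)) ^ 2 = ρ ^ 2 := by
      simp only [latticeTriangle, Finset.mem_insert, Finset.mem_singleton] at hp
      rcases hp with rfl | rfl | rfl <;> rw [power] <;> rcases hσ with rfl | rfl <;> simp
    exact (pow_left_inj₀ dist_nonneg hρ two_ne_zero).1 hsq
  · intro m n
    refine (abs_le_of_sq_le_sq' ?_ dist_nonneg).2
    rw [power]
    have h1 := mul_nonneg sB (int_mul_self_sub_nonneg (σ * (m - i)))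
    have h2 := mul_nonneg sC (int_mul_self_sub_nonneg (σ * (n - j)))
    have h3 := mul_nonneg sA (int_mul_self_sub_nonneg (σ * (m - i) + σ * (n - j)))
    linarith

/-- The barycentrically weighted mean of the squared distances from X to the vertices is ρ² minus
the squared distance from X to o. -/
theorem exists_vertex_dist_le {o X : Plane} {ρ : ℝ} (hA : dist A o = ρ) (hB : dist B o = ρ)
    (hC : dist C o = ρ) (hX : X ∈ region {A, B, C}) :
    ∃ V ∈ ({A, B, C} : Finset Plane), dist X V ≤ ρ := by
  by_contra! hcon
  have hρ : 0 ≤ ρ := hA ▸ dist_nonneg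
  have dA := pow_lt_pow_left₀ (hcon A (by simp)) hρ two_ne_zero
  have dB := pow_lt_pow_left₀ (hcon B (by simp)) hρ two_ne_zero
  have dC := pow_lt_pow_left₀ (hcon C (by simp)) hρ two_ne_zero
  have hA := congrArg (· ^ 2) hA
  have hB := congrArg (· ^ 2) hB
  have hC := congrArg (· ^ 2) hC
  simp only [dist_sq_eq] at hA hB hC dA dB dC
  obtain ⟨a, b, c, ha, hb, hc, habc, h0, h1⟩ := mem_region_iff.1 hX
  have ha1 : a = 1 - b - c := by linarith
  have e : a * ((X 0 - A 0) ^ 2 + (X 1 - A 1) ^ 2) + b * ((X 0 - B 0) ^ 2 + (X 1 - B 1) ^ 2) +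
      c * ((X 0 - C 0) ^ 2 + (X 1 - C 1) ^ 2) = ρ ^ 2 - ((X 0 - o 0) ^ 2 + (X 1 - o 1) ^ 2) := by
    rw [h0, h1, ha1]
    linear_combination (1 - b - c) * hA + b * hB + c * hC
  have hlt : ρ ^ 2 < a * ((X 0 - A 0) ^ 2 + (X 1 - A 1) ^ 2) +
      b * ((X 0 - B 0) ^ 2 + (X 1 - B 1) ^ 2) + c * ((X 0 - C 0) ^ 2 + (X 1 - C 1) ^ 2) := by
    have hh : ∀ {w d : ℝ}, 0 ≤ w → ρ ^ 2 < d → w * ρ ^ 2 ≤ w * d :=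
      fun hw hd => mul_le_mul_of_nonneg_left hd.le hw
    have hpos : 0 < a ∨ 0 < b ∨ 0 < c := by
      by_contra! hh
      linarith
    have e1 : ρ ^ 2 = a * ρ ^ 2 + b * ρ ^ 2 + c * ρ ^ 2 := by rw [← add_mul, ← add_mul, habc, one_mul]
    have i1 := hh ha dA
    have i2 := hh hb dB
    have i3 := hh hc dC
    rcases hpos with hp | hp | hp
    · linarith [mul_lt_mul_of_pos_left dA hp]
    · linarith [mul_lt_mul_of_pos_left dB hp]
    · linarith [mul_lt_mul_of_pos_left dC hp]
  nlinarith [sq_nonneg (X 0 - o 0), sq_nonneg (X 1 - o 1)]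

theorem nonObtuseInf_eq {𝒯 : Set (Finset Plane)} {a : ℝ} (hne : 𝒯.Nonempty)
    (h : ∀ t ∈ 𝒯, ¬ IsObtuse t ∧ area t = a) : nonObtuseInf 𝒯 = a := by
  have : area '' {t | t ∈ 𝒯 ∧ ¬ IsObtuse t} = {a} := by
    ext z
    simp only [Set.mem_image, Set.mem_singleton_iff]
    constructor
    · rintro ⟨t, ht, rfl⟩
      exact (h t ht.1).2
    · rintro rfl
      obtain ⟨t, ht⟩ := hne
      exact ⟨t, ⟨ht, (h t ht).1⟩, (h t ht).2⟩
  rw [nonObtuseInf, this, csInf_singleton]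

/-- A non-obtuse triangle generates an `(r,R)`-system with a Delone triangulation by copies of
the triangle. -/
theorem exists_lattice_system {r R ρ : ℝ} {o : Plane} (hr : 0 < r) (hrR : r < R)
    (hcr : cross A B C ≠ 0) (ho : ¬ IsObtuse {A, B, C}) (hAB : 2 * r ≤ dist A B)
    (hAC : 2 * r ≤ dist A C) (hBC : 2 * r ≤ dist B C) (hA : dist A o = ρ) (hB : dist B o = ρ)
    (hC : dist C o = ρ) (hρ : ρ ≤ R) :
    ∃ (P' : Set Plane) (𝒯' : Set (Finset Plane)), IsRRSystem r R P' ∧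
      IsDeloneTriangulation P' 𝒯' ∧ (∀ t ∈ 𝒯', ¬ IsObtuse t ∧ area t = area {A, B, C}) ∧
      nonObtuseInf 𝒯' = area {A, B, C} ∧ HasAverageArea 𝒯' (area {A, B, C}) := by
  have hvert : ∀ t ∈ latticeTriangulation A B C, ∀ p ∈ t, ∃ m n, p = latticePoint A B C m n := by
    rintro t ⟨σ, i, j, -, rfl⟩ p hp
    simp only [latticeTriangle, Finset.mem_insert, Finset.mem_singleton] at hp
    rcases hp with rfl | rfl | rfl <;> exact ⟨_, _, rfl⟩
  have hRR : IsRRSystem r R {X | ∃ m n : ℤ, X = latticePoint A B C m n} := by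
    refine ⟨hr, hrR, ?_, ?_⟩
    · rintro _ ⟨m, n, rfl⟩ _ ⟨i, j, rfl⟩ hne
      apply Metric.ball_disjoint_ball
      have := le_dist_latticePoint (m := m) (n := n) (i := i) (j := j) (by positivity) ho hAB hAC hBC
        (by rintro ⟨rfl, rfl⟩; exact hne rfl)
      linarith
    · refine Set.eq_univ_of_forall fun X => ?_
      obtain ⟨t, ht, hX⟩ := latticeTriangulation_cover hcr X
      obtain ⟨σ, i, j, hσ, rfl⟩ := id ht
      obtain ⟨c, hc, -⟩ := hasEmptyCircumcircle_latticeTriangle ho hA hB hC hσ i j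
      obtain ⟨V, hV, hd⟩ := exists_vertex_dist_le (hc _ (by simp [latticeTriangle]))
        (hc _ (by simp [latticeTriangle])) (hc _ (by simp [latticeTriangle])) hX
      exact Set.mem_iUnion₂.2 ⟨V, hvert _ ht V hV, Metric.mem_closedBall.2 (hd.trans hρ)⟩
  have hDel : IsDeloneTriangulation {X | ∃ m n : ℤ, X = latticePoint A B C m n}
      (latticeTriangulation A B C) := by
    refine ⟨?_, fun t ht p hp => hvert t ht p hp, ?_, ?_,
      fun s hs t ht => latticeTriangulation_face_to_face hcr hs ht⟩
    · rintro t ⟨σ, i, j, hσ, rfl⟩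
      rw [latticeTriangle, isTriangle_iff, cross_latticeTriangle hσ]
      exact hcr
    · rintro t ⟨σ, i, j, hσ, rfl⟩
      obtain ⟨c, hc, hc'⟩ := hasEmptyCircumcircle_latticeTriangle ho hA hB hC hσ i j
      refine ⟨c, ρ, hc, ?_⟩
      rintro _ ⟨m, n, rfl⟩
      exact hc' m n
    · refine Set.eq_univ_of_forall fun X => ?_
      obtain ⟨t, ht, hX⟩ := latticeTriangulation_cover hcr X
      exact Set.mem_iUnion₂.2 ⟨t, ht, hX⟩
  have hall : ∀ t ∈ latticeTriangulation A B C, ¬ IsObtuse t ∧ area t = area {A, B, C} := by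
    rintro t ⟨σ, i, j, hσ, rfl⟩
    exact ⟨not_isObtuse_latticeTriangle hσ i j ho, area_latticeTriangle hσ i j⟩
  exact ⟨_, _, hRR, hDel, hall,
    nonObtuseInf_eq ⟨_, 1, 0, 0, Or.inl rfl, rfl⟩ hall,
    hasAverageArea_of_area_eq hRR hDel fun t ht => (hall t ht).2⟩

end

/-! ### Assembly of the theorem and its sharpness -/

theorem theorem2p9 (r R : ℝ) (P : Set Plane) (hP : IsRRSystem r R P)
    (hR : R / r ≤ 2 * Real.sqrt 2)
    (𝒯 : Set (Finset Plane)) (h𝒯 : IsDeloneTriangulation P 𝒯) :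
    -- the grouping
    (∃ 𝒢 : Set (Finset (Finset Plane)), IsGrouping 𝒯 𝒢 ∧
      ∀ g ∈ 𝒢, IsGroup1 g ∨ IsGroup2 r g ∨ IsGroup3 r g ∨ IsGroup4 r g) ∧
    -- there are non-obtuse triangles, so that `nonObtuseInf 𝒯` is a genuine infimum,
    -- and the bound for the average area holds
    (∃ t ∈ 𝒯, ¬ IsObtuse t) ∧
    AverageAreaAtLeast 𝒯 (min (nonObtuseInf 𝒯) (2 * r ^ 2)) ∧
    -- sharpness with respect to `V₀`: there are `(r,R)`-systems all of whose Delone triangles are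
    -- non-obtuse of the same area `a`, with `a` arbitrarily close to `V₀`
    (∀ ε : ℝ, 0 < ε → ∃ (P' : Set Plane) (𝒯' : Set (Finset Plane)) (a : ℝ),
      IsRRSystem r R P' ∧ IsDeloneTriangulation P' 𝒯' ∧
      nonObtuseInf 𝒯 ≤ a ∧ a < nonObtuseInf 𝒯 + ε ∧
      (∀ t ∈ 𝒯', ¬ IsObtuse t ∧ area t = a) ∧
      nonObtuseInf 𝒯' = a ∧ HasAverageArea 𝒯' a) ∧
    -- sharpness with respect to `2 r ^ 2`: there is an `(r, √2 r)`-system all of whose Delone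
    -- triangles are non-obtuse of area `2 r ^ 2`
    (∃ (P' : Set Plane) (𝒯' : Set (Finset Plane)),
      IsRRSystem r (Real.sqrt 2 * r) P' ∧ IsDeloneTriangulation P' 𝒯' ∧
      (∀ t ∈ 𝒯', ¬ IsObtuse t ∧ area t = 2 * r ^ 2) ∧
      nonObtuseInf 𝒯' = 2 * r ^ 2 ∧ HasAverageArea 𝒯' (2 * r ^ 2)) := by
  have hr := hP.r_pos
  have hR2 : R ^ 2 ≤ 8 * r ^ 2 := by
    rw [div_le_iff₀ hr] at hR
    have h1 := pow_le_pow_left₀ (hr.trans hP.r_lt_R).le hR 2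
    have h2 := Real.sq_sqrt (show (0 : ℝ) ≤ 2 by norm_num)
    nlinarith
  obtain ⟨𝒢, hG, htype⟩ := h𝒯.exists_grouping hP hR2
  have hne := h𝒯.exists_nonobtuse hP
  refine ⟨⟨𝒢, hG, htype⟩, hne, h𝒯.averageAreaAtLeast hP hR2 hG htype, ?_, ?_⟩
  · intro ε hε
    -- A non-obtuse triangle with area within ε of the infimum generates the required lattice; its
    -- sides and circumradius satisfy the bounds because it comes from 𝒯.
    obtain ⟨_, ⟨T, ⟨hT, ho⟩, rfl⟩, hlt⟩ := exists_lt_of_csInf_lt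
      (s := area '' {t | t ∈ 𝒯 ∧ ¬ IsObtuse t})
      (by obtain ⟨t, ht⟩ := hne; exact ⟨_, t, ht, rfl⟩)
      (show nonObtuseInf 𝒯 < nonObtuseInf 𝒯 + ε by linarith)
    obtain ⟨A, B, C, rfl, hcr⟩ := (h𝒯.isTriangle T hT).exists_eq
    obtain ⟨hAB, hAC, hBC⟩ := ne_of_cross_ne_zero hcr
    have hv := h𝒯.vertices _ hT
    obtain ⟨o, ρ, h1, -, -, h4⟩ := h𝒯.exists_circumcircle hP hT
    obtain ⟨P', 𝒯', b1, b2, b3, b4, b5⟩ := exists_lattice_system hr hP.r_lt_R hcr ho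
      (hP.two_mul_le_dist (hv (by simp)) (hv (by simp)) hAB)
      (hP.two_mul_le_dist (hv (by simp)) (hv (by simp)) hAC)
      (hP.two_mul_le_dist (hv (by simp)) (hv (by simp)) hBC)
      (h1 A (by simp)) (h1 B (by simp)) (h1 C (by simp)) h4
    exact ⟨P', 𝒯', _, b1, b2, nonObtuseInf_le hT ho, hlt, b3, b4, b5⟩
  · have hs2 : 1 < Real.sqrt 2 := by
      rw [Real.lt_sqrt zero_le_one]; norm_num
    have hsq := Real.sq_sqrt (show (0 : ℝ) ≤ 2 by norm_num)
    -- Half of a square of side 2r: a right triangle with circumradius √2 r, centred at (r, r).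
    have harea : area {!₂[0, 0], !₂[2 * r, 0], !₂[0, 2 * r]} = 2 * r ^ 2 := by
      rw [area_eq, cross]
      simp only [Matrix.cons_val_zero, Matrix.cons_val_one]
      rw [abs_of_nonneg (by nlinarith)]
      ring
    rw [← harea]
    have hd : ∀ {X Y : Plane} {d : ℝ}, 0 ≤ d → dist X Y ^ 2 = d ^ 2 → dist X Y = d :=
      fun hd h => (pow_left_inj₀ dist_nonneg hd two_ne_zero).1 h
    have hle : ∀ {X Y : Plane}, (2 * r) ^ 2 ≤ dist X Y ^ 2 → 2 * r ≤ dist X Y :=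
      fun h => (abs_le_of_sq_le_sq' h dist_nonneg).2
    refine exists_lattice_system (o := !₂[r, r]) (ρ := Real.sqrt 2 * r) hr (by nlinarith) ?_ ?_
      (hle ?_) (hle ?_) (hle ?_) (hd (by positivity) ?_) (hd (by positivity) ?_)
      (hd (by positivity) ?_) le_rfl
    · simp only [cross, Matrix.cons_val_zero, Matrix.cons_val_one]
      have : 0 < r * r := by positivity
      nlinarith
    · rw [isObtuse_iff]
      push Not
      simp only [scal, Matrix.cons_val_zero, Matrix.cons_val_one]
      refine ⟨?_, ?_, ?_⟩ <;> nlinarith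
    all_goals
      rw [dist_sq_eq]
      simp only [Matrix.cons_val_zero, Matrix.cons_val_one]
      nlinarith
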